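/- Let $T$ be the balanced hierarchically separated tree with branching factor $b\ge 2$ (every inner node has $b$ children), depth $\delta\ge 0$ (every leaf is at level $\delta$) and weight ratio $\lambda$, $0<\lambda<1$, $b\lambda\ge 1$: every edge between levels $i-1$ and $i$ has length $\lambda^i$. Let $\Omega$ be the set of leaves with the path metric $d_T$ and the uniform probability measure $\mu$, and let $X=(X_1,\dots,X_n)$, $n\ge 1$, be distributed according to the product measure $\mu^n$ on $\Omega^n$. For $X\in\Omega^n$ consider the complete graph on $\{1,\dots,n\}$ in which the edge $ij$ has weight $d_T(X_i,X_j)$. Let $M(X)$ be the minimum cost of a matching that covers all vertices ($n$ even), or all vertices but one ($n$ odd); let $TSP(X)$ be the length of a shortest closed tour through all vertices (for $n=2$ it goes forth and back, for $n=1$ it has length $0$); let $MST(X)$ be the minimum cost of a spanning tree. Put $Top(k)=\sum_{i=1}^{\min(\delta,\lceil\log_b k\rceil)}(b\lambda)^i$, the sum of the edge lengths of the first $\lceil \log_b k\rceil$ levels of $T$, and let $H(X,Y)=|\{i: X_i\ne Y_i\}|$. A functional $L:\Omega^n\to\mathbb R$ is called smooth with constant $K>0$ if $$L(X)\le L(Y)+K\cdot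 Top(k)/(1-\lambda)\qquad\text{for all } X,Y\in\Omega^n \text{ and all } k\ge 2 \text{ with } H(X,Y)\le k .$$ (1) For all such $b,\delta,\lambda,n$, the functional $M$ is smooth with constant $2$, $TSP$ is smooth with constant $8$, and $MST$ is smooth with an absolute constant $K$. (2) Let $\lambda=1/2$, and let $L$ be a functional that is smooth with constant $K$. Then for all $t\ge 0$: - if $b\ge 3$, then $\mathbf P(|L(X)-\mathbf EL(X)|\ge t)\le 8\exp\left(-\dfrac{t^{2/\log_b(b/2)}}{c\,n}\right)$; - if $b=2^d$ with an integer $d\ge 2$, then $\mathbf P(|L(X)-\mathbf EL(X)|\ge t)\le 8\exp\left(-\dfrac{t^{2d/(d-1)}}{c\,n}\right)$; - if $b=2$, then $\mathbf P(|L(X)-\mathbf EL(X)|\ge t)\le 8\exp\left(-\dfrac{2^{t/c}}{8n}\right)$, where $c>0$ depends only on $b$ and $K$ (not on $\delta$, $n$, $t$ or $L$). (3) In particular, for $\lambda=1/2$ the three inequalities hold for each of $L=M$, $L=TSP$, $L=MST$, with a constant $c>0$ that depends only on $b$. -/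

import Mathlib

open MeasureTheory ProbabilityTheory

noncomputable section

namespace HST

/-- The nodes of the balanced tree of depth `δ` in which every inner node has `b` children.
A node of level `ℓ` is a word of length `ℓ` over `Fin b`; the root is the empty word. -/
abbrev Node (b δ : ℕ) : Type := Σ ℓ : Fin (δ + 1), (Fin (ℓ : ℕ) → Fin b)

/-- The leaves are the nodes of level `δ`. -/
abbrev Leaf (b δ : ℕ) : Type := Fin δ → Fin b

variable {b δ n : ℕ}

/-- The level (depth) of a node; the root has level `0`. -/
def Node.level (v : Node b δ) : ℕ := (v.1 : ℕ)

/-- `v` is the parent of `u`: the word `u` is the word `v` followed by one more letter. -/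
def IsParent (v u : Node b δ) : Prop :=
  ∃ h : (u.1 : ℕ) = (v.1 : ℕ) + 1,
    ∀ i : Fin (v.1 : ℕ), u.2 ⟨(i : ℕ), by omega⟩ = v.2 i

/-- The underlying graph of the tree. -/
def tree (b δ : ℕ) : SimpleGraph (Node b δ) where
  Adj u v := IsParent u v ∨ IsParent v u
  symm := ⟨fun _ _ h => Or.symm h⟩
  loopless := ⟨fun v h => by
    rcases h with ⟨h, -⟩ | ⟨h, -⟩ <;> omega⟩

/-- The weight of an edge is `lam ^ ℓ`, where `ℓ` is the level of its lower end. -/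
def edgeWeight (lam : ℝ) (u v : Node b δ) : ℝ := lam ^ max u.level v.level

/-- The total weight of a walk in the tree. -/
def walkWeight (lam : ℝ) {u v : Node b δ} (p : (tree b δ).Walk u v) : ℝ :=
  (p.darts.map fun e => edgeWeight lam e.fst e.snd).sum

/-- A leaf as a node of the tree. -/
def Leaf.toNode (x : Leaf b δ) : Node b δ := ⟨Fin.last δ, x⟩

/-- The distance of two leaves: the weight of the path that joins them in the tree
(the path is unique, so the infimum is over a single number). -/
def leafDist (lam : ℝ) (x y : Leaf b δ) : ℝ :=
  sInf {w : ℝ | ∃ p : (tree b δ).Walk x.toNode y.toNode, p.IsPath ∧ w = walkWeight lam p}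

theorem walkWeight_reverse (lam : ℝ) {u v : Node b δ} (p : (tree b δ).Walk u v) :
    walkWeight lam p.reverse = walkWeight lam p := by
  simp only [walkWeight, SimpleGraph.Walk.darts_reverse, List.map_reverse, List.sum_reverse,
    List.map_map]
  congr 1
  apply List.map_congr_left
  intro e _
  simp [edgeWeight, max_comm]

theorem leafDist_comm (lam : ℝ) (x y : Leaf b δ) : leafDist lam x y = leafDist lam y x := by
  unfold leafDist
  congr 1
  ext w
  constructor <;> rintro ⟨p, hp, rfl⟩ <;>
    exact ⟨p.reverse, hp.reverse, (walkWeight_reverse lam p).symm⟩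

/-- The weight of the edge `{i, j}` of the complete graph on the `n` points
`X 0, …, X (n - 1)`; repeated leaves are distinguished by their indices. -/
def pairWeight (lam : ℝ) (X : Fin n → Leaf b δ) : Sym2 (Fin n) → ℝ :=
  Sym2.lift ⟨fun i j => leafDist lam (X i) (X j), fun _ _ => leafDist_comm lam _ _⟩

/-- A matching of the complete graph on `n` vertices that covers all vertices if `n` is even,
and all vertices but one if `n` is odd. -/
def IsFullMatching (M : (⊤ : SimpleGraph (Fin n)).Subgraph) : Prop :=
  M.IsMatching ∧ (Even n → M.verts = Set.univ) ∧ (Odd n → ∃ v, M.verts = {v}ᶜ)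

open Classical in
/-- The cost of a minimum matching. -/
def matchingCost (lam : ℝ) (X : Fin n → Leaf b δ) : ℝ :=
  sInf {c : ℝ | ∃ M : (⊤ : SimpleGraph (Fin n)).Subgraph, IsFullMatching M ∧
    c = ∑ e : Sym2 (Fin n) with e ∈ M.edgeSet, pairWeight lam X e}

/-- The length of a shortest closed tour: a tour visits the points in the cyclic order
`σ 0, σ 1, …, σ (n - 1), σ 0`. For `n = 2` it goes forth and back. -/
def tspCost (lam : ℝ) (X : Fin n → Leaf b δ) : ℝ :=
  sInf {c : ℝ | ∃ σ : Equiv.Perm (Fin n),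
    c = ∑ i : Fin n, leafDist lam (X (σ i)) (X (σ (finRotate n i)))}

open Classical in
/-- The cost of a minimum spanning tree. -/
def mstCost (lam : ℝ) (X : Fin n → Leaf b δ) : ℝ :=
  sInf {c : ℝ | ∃ F : SimpleGraph (Fin n), F.IsTree ∧
    c = ∑ e : Sym2 (Fin n) with e ∈ F.edgeSet, pairWeight lam X e}

/-- The sum of the edge lengths of the first `⌈log_b k⌉` levels of the tree (of all its levels
if it has fewer): there are `b ^ i` edges of length `lam ^ i` in level `i`.
Here `Nat.clog b k` is `⌈log_b k⌉`. -/
def Top (b δ : ℕ) (lam : ℝ) (k : ℕ) : ℝ :=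
  ∑ i ∈ Finset.Icc 1 (min δ (Nat.clog b k)), (b : ℝ) ^ i * lam ^ i

/-- The smoothness of a functional under Hamming changes, with constant `K`. -/
def IsSmooth (lam K : ℝ) (L : (Fin n → Leaf b δ) → ℝ) : Prop :=
  ∀ (X Y : Fin n → Leaf b δ) (k : ℕ), 2 ≤ k → hammingDist X Y ≤ k →
    L X ≤ L Y + K * Top b δ lam k / (1 - lam)

/-- The law of `n` independent, uniformly distributed leaves. -/
def leafMeasure (b δ n : ℕ) : Measure (Fin n → Leaf b δ) :=
  Measure.pi fun _ => uniformOn (Set.univ : Set (Leaf b δ))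

/-- The probability that `L(X)` differs from its mean by at least `t`. -/
def deviationProb (L : (Fin n → Leaf b δ) → ℝ) (t : ℝ) : ℝ :=
  (leafMeasure b δ n).real {X | t ≤ |L X - ∫ Y, L Y ∂(leafMeasure b δ n)|}

/-- The three monochromatic functionals: minimum matching, shortest tour, minimum spanning
tree. -/
def monochromatic (b δ n : ℕ) (lam : ℝ) : Set ((Fin n → Leaf b δ) → ℝ) :=
  {matchingCost lam, tspCost lam, mstCost lam}

end HST

end

/-! Everything rests on the level decomposition `leafDist_eq`: the distance of two leaves is the
sum, over the levels `ℓ` at which their prefixes differ, of `2 * lam ^ ℓ`. The cost of a matching,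
tour or tree is thus a weighted sum of the numbers of its edges that cross between subtrees of each
level. Repeatedly treating a closest pair (`exists_closest_pair`) yields one structure on a set `U`
that is good at all levels simultaneously: its crossings at level `ℓ` are bounded by the number of
subtrees of that level that meet `U` (`exists_tour`, `exists_matching`, `exists_connecting_edges`).
This number is at most `b ^ ℓ` and at most the size of `U`. If `U` has at most `2 * k` points, the
first bound on the top `⌈log_b k⌉` levels gives `Top`, and the second makes the deeper levels a
geometric tail of comparable size (`sum_levels_le`).

For smoothness, an optimal matching or tour for `Y` is kept where `X` and `Y` agree and rebuilt
cheaply on the at most `2 * k` points that are affected. The spanning tree has an exact formula,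
`mstCost_eq`, in which the number of occupied subtrees grows by at most the number that the changed
points occupy.

For concentration with `lam = 1/2` and `b ≥ 3`, `Top` grows like `k ^ α` with `α = log_b (b/2)`, so
a smooth functional is Hölder for the Hamming distance (`IsSmooth.holder`). Its excess over a median
is then controlled by the `α`-th power of the distance to a sublevel set of at least half the space.
That distance is 1-Lipschitz and has Gaussian tails by a moment generating function argument
(`expect_exp_le_of_lipschitz`), and its mean is `O(√n)`, which also compares the median with the
mean. For small `t` the claimed bound exceeds 1.

For `b = 2` every level contributes 1 to `Top`, so the functional oscillates by `O(log n)` only.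
Larger deviations are impossible, and for smaller ones the bound exceeds 1. -/

noncomputable section

namespace HST

variable {b δ n : ℕ}

/-! ### The distance of two leaves -/

/-- The word formed by the first `ℓ` letters of a leaf. -/
def pre (ℓ : ℕ) (x : Leaf b δ) : Fin (min ℓ δ) → Fin b :=
  fun i => x (Fin.castLE (min_le_right _ _) i)

theorem pre_eq_iff {ℓ : ℕ} {x y : Leaf b δ} :
    pre ℓ x = pre ℓ y ↔ ∀ i : Fin δ, (i : ℕ) < ℓ → x i = y i := by
  constructor
  · intro h i hi
    exact congrFun h ⟨i, lt_min hi i.2⟩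
  · intro h
    funext i
    exact h _ (lt_of_lt_of_le i.2 (min_le_left _ _))

theorem pre_eq_of_le {ℓ m : ℕ} (hm : m ≤ ℓ) {x y : Leaf b δ} (h : pre ℓ x = pre ℓ y) :
    pre m x = pre m y :=
  pre_eq_iff.2 fun i hi => pre_eq_iff.1 h i (hi.trans_le hm)

theorem pre_zero (x y : Leaf b δ) : pre 0 x = pre 0 y :=
  pre_eq_iff.2 fun _ hi => absurd hi (Nat.not_lt_zero _)

/-- The node `u` lies in the subtree whose root is the ancestor of `x` at level `ℓ`. -/
def Below (x : Leaf b δ) (ℓ : ℕ) (u : Node b δ) : Prop :=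
  ℓ ≤ u.level ∧ ∀ i : Fin (u.1 : ℕ), (i : ℕ) < ℓ → u.2 i = x ⟨i, by omega⟩

theorem below_toNode (x y : Leaf b δ) {ℓ : ℕ} (hℓ : ℓ ≤ δ) :
    Below x ℓ y.toNode ↔ pre ℓ x = pre ℓ y := by
  rw [pre_eq_iff]
  constructor
  · rintro ⟨-, h⟩ i hi
    exact (h i hi).symm
  · intro h
    exact ⟨hℓ, fun i hi => (h i hi).symm⟩

/-- Passing to the parent forgets only the last letter, so membership in a subtree can change only
for subtrees rooted at the level of `u`. -/
theorem below_parent_iff {v u : Node b δ} (h : IsParent v u) (x : Leaf b δ) {ℓ : ℕ}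
    (hℓ : ℓ ≠ u.level) : Below x ℓ u ↔ Below x ℓ v := by
  obtain ⟨h1, h2⟩ := h
  unfold Below Node.level at *
  constructor
  · rintro ⟨h3, h4⟩
    refine ⟨by omega, fun i hi => ?_⟩
    rw [← h2 i]
    exact h4 ⟨i, by omega⟩ hi
  · rintro ⟨h3, h4⟩
    refine ⟨by omega, fun i hi => ?_⟩
    have h5 := h2 ⟨i, by omega⟩
    rw [h4 ⟨i, by omega⟩ hi] at h5
    exact h5

open Classical in
/-- A function on the nodes that is `1`-Lipschitz along the edges of the tree and that
measures the distance of the leaves `x` and `y`. -/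
def potential (lam : ℝ) (x y : Leaf b δ) (u : Node b δ) : ℝ :=
  ∑ ℓ ∈ Finset.Icc 1 δ, lam ^ ℓ * ((if Below x ℓ u then 1 else 0) - if Below y ℓ u then 1 else 0)

-- Only the summand at the level of the lower node changes along an edge, and its bracket stays in
-- `[-1, 1]`.
open Classical in
theorem abs_potential_sub_le_of_isParent {lam : ℝ} (h0 : 0 ≤ lam) (x y : Leaf b δ)
    {v u : Node b δ} (h : IsParent v u) :
    |potential lam x y u - potential lam x y v| ≤ lam ^ u.level := by
  have hu : u.level ∈ Finset.Icc 1 δ := by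
    obtain ⟨h1, -⟩ := h
    have := u.1.2
    simp only [Node.level, Finset.mem_Icc]
    omega
  have hv : ∀ z : Leaf b δ, ¬ Below z u.level v := by
    rintro z ⟨h3, -⟩
    obtain ⟨h1, -⟩ := h
    simp only [Node.level] at h3
    omega
  unfold potential
  rw [← Finset.sum_sub_distrib, Finset.sum_eq_single_of_mem _ hu]
  · rw [if_neg (hv x), if_neg (hv y), ← mul_sub, abs_mul, abs_of_nonneg (pow_nonneg h0 _)]
    refine mul_le_of_le_one_right (pow_nonneg h0 _) ?_
    split_ifs <;> norm_num
  · intro ℓ _ hℓ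
    simp only [below_parent_iff h _ hℓ, sub_self]

theorem potential_sub_le_walkWeight {lam : ℝ} (h0 : 0 ≤ lam) (x y : Leaf b δ) {u v : Node b δ}
    (p : (tree b δ).Walk u v) :
    potential lam x y u - potential lam x y v ≤ walkWeight lam p := by
  induction p with
  | nil => simp [walkWeight]
  | @cons u w v h p ih =>
    have h1 : walkWeight lam (.cons h p) = edgeWeight lam u w + walkWeight lam p := by
      simp [walkWeight]
    have h2 : potential lam x y u - potential lam x y w ≤ edgeWeight lam u w := by
      unfold edgeWeight
      rcases h with h | h
      · have := abs_potential_sub_le_of_isParent h0 x y h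
        have hl : max u.level w.level = w.level := by
          obtain ⟨h1, -⟩ := h
          simp only [Node.level]; omega
        rw [hl]
        linarith [neg_le_abs (potential lam x y w - potential lam x y u)]
      · have := abs_potential_sub_le_of_isParent h0 x y h
        have hl : max u.level w.level = u.level := by
          obtain ⟨h1, -⟩ := h
          simp only [Node.level]; omega
        rw [hl]
        linarith [le_abs_self (potential lam x y u - potential lam x y w)]
    linarith

/-- The ancestor of a leaf at level `m`. -/
def ancestor (x : Leaf b δ) (m : ℕ) (hm : m < δ + 1) : Node b δ :=
  ⟨⟨m, hm⟩, fun i => x ⟨i, by have := i.2; simp only at this; omega⟩⟩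

theorem exists_walk_ancestor (lam : ℝ) (x : Leaf b δ) (m : ℕ) (hm : m < δ + 1) (j : ℕ)
    (hj : m + j < δ + 1) :
    ∃ p : (tree b δ).Walk (ancestor x m hm) (ancestor x (m + j) hj),
      walkWeight lam p = ∑ ℓ ∈ Finset.Ioc m (m + j), lam ^ ℓ := by
  induction j with
  | zero => exact ⟨.nil, by simp [walkWeight]⟩
  | succ j ih =>
    obtain ⟨p, hp⟩ := ih (by omega)
    have h : (tree b δ).Adj (ancestor x (m + j) (by omega)) (ancestor x (m + (j + 1)) hj) :=
      Or.inl ⟨rfl, fun i => rfl⟩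
    refine ⟨p.concat h, ?_⟩
    have h1 : walkWeight lam (p.concat h) = walkWeight lam p + lam ^ (m + j + 1) := by
      rw [walkWeight, SimpleGraph.Walk.darts_concat, List.concat_eq_append, List.map_append,
        List.sum_append]
      simp [walkWeight, edgeWeight, ancestor, Node.level, add_assoc]
    rw [h1, hp, ← add_assoc, ← Finset.sum_Ioc_succ_top (by omega)]

-- The upper bound comes from the walk through the lowest common ancestor, the lower bound from the
-- potential, whose drop from `x` to `y` is exactly this sum. No uniqueness of paths is needed.
open Classical in
theorem leafDist_eq {lam : ℝ} (h0 : 0 ≤ lam) (x y : Leaf b δ) :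
    leafDist lam x y =
      ∑ ℓ ∈ Finset.Icc 1 δ, 2 * lam ^ ℓ * if pre ℓ x = pre ℓ y then 0 else 1 := by
  have hpot : potential lam x y x.toNode - potential lam x y y.toNode =
      ∑ ℓ ∈ Finset.Icc 1 δ, 2 * lam ^ ℓ * if pre ℓ x = pre ℓ y then 0 else 1 := by
    unfold potential
    rw [← Finset.sum_sub_distrib]
    refine Finset.sum_congr rfl fun ℓ hℓ => ?_
    have hℓ' := (Finset.mem_Icc.1 hℓ).2
    simp only [below_toNode _ _ hℓ', eq_comm (a := pre ℓ y)]
    split_ifs <;> simp <;> ring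
  obtain ⟨w, hw⟩ : ∃ w : (tree b δ).Walk x.toNode y.toNode, walkWeight lam w =
      ∑ ℓ ∈ Finset.Icc 1 δ, 2 * lam ^ ℓ * if pre ℓ x = pre ℓ y then 0 else 1 := by
    -- `m` is the level of the lowest common ancestor: the walk climbs from `x` to it and descends
    -- to `y`.
    set m := Nat.findGreatest (fun ℓ => pre ℓ x = pre ℓ y) δ with hm
    have hmδ : m ≤ δ := Nat.findGreatest_le δ
    have hpm : pre m x = pre m y :=
      Nat.findGreatest_spec (P := fun ℓ => pre ℓ x = pre ℓ y) (Nat.zero_le δ) (pre_zero x y)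
    obtain ⟨p, hp⟩ := exists_walk_ancestor lam x m (by omega) (δ - m) (by omega)
    obtain ⟨q, hq⟩ := exists_walk_ancestor lam y m (by omega) (δ - m) (by omega)
    have hanc : ancestor x m (by omega) = ancestor y m (by omega) := by
      unfold ancestor
      congr 1
      funext i
      exact pre_eq_iff.1 hpm _ i.2
    have hend : ∀ z : Leaf b δ, ancestor z (m + (δ - m)) (by omega) = z.toNode := by
      intro z
      have : ∀ k (hk : k < δ + 1), k = δ → ancestor z k hk = z.toNode := by
        rintro k hk rfl
        rfl
      exact this _ _ (by omega)
    refine ⟨((p.reverse.copy (hend x) hanc).append (q.copy rfl (hend y))), ?_⟩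
    have hcopy : ∀ {u v u' v' : Node b δ} (r : (tree b δ).Walk u v) (hu : u = u') (hv : v = v'),
        walkWeight lam (r.copy hu hv) = walkWeight lam r := by
      rintro u v _ _ r rfl rfl
      rfl
    have happ : ∀ {u v z : Node b δ} (r : (tree b δ).Walk u v) (s : (tree b δ).Walk v z),
        walkWeight lam (r.append s) = walkWeight lam r + walkWeight lam s := by
      intro u v z r s
      simp [walkWeight]
    rw [happ, hcopy, hcopy, walkWeight_reverse, hp, hq, ← two_mul, Finset.mul_sum]
    have hs : Finset.Ioc m (m + (δ - m)) = (Finset.Icc 1 δ).filter (fun ℓ => pre ℓ x ≠ pre ℓ y) := by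
      ext ℓ
      simp only [Finset.mem_Ioc, Finset.mem_filter, Finset.mem_Icc]
      constructor
      · rintro ⟨h1, h2⟩
        exact ⟨by omega, Nat.findGreatest_is_greatest (P := fun ℓ => pre ℓ x = pre ℓ y) h1 (by omega)⟩
      · rintro ⟨h1, h2⟩
        refine ⟨?_, by omega⟩
        by_contra h3
        exact h2 (pre_eq_of_le (by omega) hpm)
    rw [hs, Finset.sum_filter]
    refine Finset.sum_congr rfl fun ℓ _ => ?_
    by_cases h : pre ℓ x = pre ℓ y <;> simp [h]
  apply le_antisymm
  · rw [← hw]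
    -- Cutting the loops out of `w` yields a path and, the weights being nonnegative, does not
    -- increase the weight.
    have hle : leafDist lam x y ≤ walkWeight lam w.bypass := by
      refine csInf_le ⟨0, ?_⟩ ⟨w.bypass, w.bypass_isPath, rfl⟩
      rintro _ ⟨p, -, rfl⟩
      refine List.sum_nonneg fun c hc => ?_
      obtain ⟨e, -, rfl⟩ := List.mem_map.1 hc
      exact pow_nonneg h0 _
    · refine hle.trans ?_
      refine List.Sublist.sum_le_sum (w.darts_bypass_sublist_darts.map _) fun c hc => ?_
      obtain ⟨e, -, rfl⟩ := List.mem_map.1 hc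
      exact pow_nonneg h0 _
  · refine le_csInf ⟨_, w.bypass, w.bypass_isPath, rfl⟩ ?_
    rintro _ ⟨p, -, rfl⟩
    rw [← hpot]
    exact potential_sub_le_walkWeight h0 x y p

theorem leafDist_nonneg {lam : ℝ} (h0 : 0 ≤ lam) (x y : Leaf b δ) : 0 ≤ leafDist lam x y := by
  classical
  rw [leafDist_eq h0]
  exact Finset.sum_nonneg fun ℓ _ => mul_nonneg (by positivity) (by split_ifs <;> norm_num)

theorem leafDist_self {lam : ℝ} (h0 : 0 ≤ lam) (x : Leaf b δ) : leafDist lam x x = 0 := by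
  classical
  simp [leafDist_eq h0]

theorem leafDist_triangle {lam : ℝ} (h0 : 0 ≤ lam) (x y z : Leaf b δ) :
    leafDist lam x z ≤ leafDist lam x y + leafDist lam y z := by
  classical
  rw [leafDist_eq h0, leafDist_eq h0, leafDist_eq h0, ← Finset.sum_add_distrib]
  refine Finset.sum_le_sum fun ℓ _ => ?_
  rw [← mul_add]
  refine mul_le_mul_of_nonneg_left ?_ (by positivity)
  by_cases h1 : pre ℓ x = pre ℓ y <;> by_cases h2 : pre ℓ y = pre ℓ z <;>
    by_cases h3 : pre ℓ x = pre ℓ z <;> simp_all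

/-! ### Classes of points that share a prefix -/

section Classes

variable {ι : Type*}

/-- Whether the points `X i` and `X j` lie in different subtrees of level `ℓ`. -/
def split (X : ι → Leaf b δ) (ℓ : ℕ) (i j : ι) : ℕ := if pre ℓ (X i) = pre ℓ (X j) then 0 else 1

theorem split_comm (X : ι → Leaf b δ) (ℓ : ℕ) (i j : ι) : split X ℓ i j = split X ℓ j i := by
  simp [split, eq_comm]

theorem split_le_one (X : ι → Leaf b δ) (ℓ : ℕ) (i j : ι) : split X ℓ i j ≤ 1 := by
  unfold split; split_ifs <;> simp

theorem leafDist_eq_sum_split {lam : ℝ} (h0 : 0 ≤ lam) (X : ι → Leaf b δ) (i j : ι) :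
    leafDist lam (X i) (X j) = ∑ ℓ ∈ Finset.Icc 1 δ, 2 * lam ^ ℓ * (split X ℓ i j : ℝ) := by
  rw [leafDist_eq h0]
  refine Finset.sum_congr rfl fun ℓ _ => ?_
  by_cases h : pre ℓ (X i) = pre ℓ (X j) <;> simp [split, h]

/-- The number of subtrees of level `ℓ` that contain a point with index in `U`. -/
def numClasses (X : ι → Leaf b δ) (ℓ : ℕ) (U : Finset ι) : ℕ :=
  (U.image fun i => pre ℓ (X i)).card

theorem numClasses_mono (X : ι → Leaf b δ) (ℓ : ℕ) {U V : Finset ι} (h : U ⊆ V) :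
    numClasses X ℓ U ≤ numClasses X ℓ V :=
  Finset.card_le_card (Finset.image_subset_image h)

theorem numClasses_le_card (X : ι → Leaf b δ) (ℓ : ℕ) (U : Finset ι) :
    numClasses X ℓ U ≤ U.card := Finset.card_image_le

theorem numClasses_eq_card {X : ι → Leaf b δ} {ℓ : ℕ} {U : Finset ι}
    (h : Set.InjOn (fun i => pre ℓ (X i)) U) : numClasses X ℓ U = U.card :=
  Finset.card_image_of_injOn h

theorem numClasses_le_pow (hb : 1 ≤ b) (X : ι → Leaf b δ) (ℓ : ℕ) (U : Finset ι) :
    numClasses X ℓ U ≤ b ^ ℓ := by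
  refine (Finset.card_le_univ _).trans ?_
  simpa using Nat.pow_le_pow_right hb (min_le_left ℓ δ)

/-- Among the pairs of points there is one that is separated only at levels at which all
points are separated. -/
theorem exists_closest_pair (X : ι → Leaf b δ) (U : Finset ι) (hU : 1 < U.card) :
    ∃ x ∈ U, ∃ y ∈ U, x ≠ y ∧
      ∀ ℓ ≤ δ, split X ℓ x y ≠ 0 → Set.InjOn (fun i => pre ℓ (X i)) U := by
  classical
  set P : ℕ → Prop := fun ℓ => ¬ Set.InjOn (fun i => pre ℓ (X i)) U with hP
  have h0 : P 0 := by
    obtain ⟨x, hx, y, hy, hxy⟩ := Finset.one_lt_card.1 hU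
    exact fun h => hxy (h hx hy (pre_zero _ _))
  -- Two points that still agree at the deepest level with any agreement agree at all higher levels
  -- too, so they are separated only where every two points are.
  have hm : P (Nat.findGreatest P δ) := Nat.findGreatest_spec (Nat.zero_le δ) h0
  simp only [hP, Set.InjOn] at hm
  push Not at hm
  obtain ⟨x, hx, y, hy, h1, h2⟩ := hm
  refine ⟨x, hx, y, hy, h2, fun ℓ hℓ hs => ?_⟩
  by_contra h3
  refine hs ?_
  rw [split, if_pos (pre_eq_of_le (Nat.le_findGreatest hℓ h3) h1)]

end Classes

/-! ### Trails -/

section Trail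

variable {ι : Type*} {M : Type*}

/-- The length of the trail from `a` to `z` through the points of a list, for the distances
given by `d`. -/
def trail [Add M] (d : ι → ι → M) (a z : ι) : List ι → M
  | [] => d a z
  | x :: l => d a x + trail d x z l

theorem trail_append [AddSemigroup M] (d : ι → ι → M) (a x z : ι) (l₁ l₂ : List ι) :
    trail d a z (l₁ ++ x :: l₂) = trail d a x l₁ + trail d x z l₂ := by
  induction l₁ generalizing a with
  | nil => rfl
  | cons y l ih => simp [trail, ih, add_assoc]

theorem trail_congr_left [Add M] (d : ι → ι → M) {a a' : ι} (h : ∀ j, d a j = d a' j) (z : ι)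
    (l : List ι) : trail d a z l = trail d a' z l := by
  cases l <;> simp [trail, h]

theorem trail_congr [Add M] (d d' : ι → ι → M) (P : ι → Prop)
    (h : ∀ i j, P i → P j → d i j = d' i j) {a z : ι} (ha : P a) (hz : P z) {l : List ι}
    (hl : ∀ x ∈ l, P x) : trail d a z l = trail d' a z l := by
  induction l generalizing a with
  | nil => exact h a z ha hz
  | cons y l ih =>
    simp only [List.mem_cons, forall_eq_or_imp] at hl
    simp only [trail, h a y ha hl.1, ih hl.1 hl.2]

theorem trail_le_length (d : ι → ι → ℕ) (h : ∀ i j, d i j ≤ 1) (a z : ι) (l : List ι) :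
    trail d a z l ≤ l.length + 1 := by
  induction l generalizing a with
  | nil => exact h a z
  | cons y l ih =>
    have := ih y
    have := h a y
    simp only [trail, List.length_cons]
    omega

theorem trail_nonneg {d : ι → ι → ℝ} (h : ∀ i j, 0 ≤ d i j) (a z : ι) (l : List ι) :
    0 ≤ trail d a z l := by
  induction l generalizing a with
  | nil => exact h a z
  | cons y l ih => exact add_nonneg (h _ _) (ih y)

theorem trail_le_add {d : ι → ι → ℝ} (ht : ∀ i j k, d i k ≤ d i j + d j k) (a w z : ι)
    (l : List ι) : trail d a z l ≤ trail d a w l + d w z := by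
  induction l generalizing a with
  | nil => exact ht a w z
  | cons y l ih =>
    have := ih y
    simp only [trail]
    linarith

theorem trail_le_add_left {d : ι → ι → ℝ} (ht : ∀ i j k, d i k ≤ d i j + d j k) (a w z : ι)
    (l : List ι) : trail d a z l ≤ d a w + trail d w z l := by
  cases l with
  | nil => exact ht a w z
  | cons y l =>
    have := ht a w y
    simp only [trail]
    linarith

theorem trail_append_le {d : ι → ι → ℝ} (ht : ∀ i j k, d i k ≤ d i j + d j k) (a w z : ι)
    (l₁ l₂ : List ι) : trail d a z (l₁ ++ l₂) ≤ trail d a w l₁ + trail d w z l₂ := by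
  cases l₂ with
  | nil => simpa [trail] using trail_le_add ht a w z l₁
  | cons x l =>
    rw [trail_append]
    have := trail_le_add ht a w x l₁
    simp only [trail]
    linarith

/-- Shortcutting: by the triangle inequality, skipping points does not lengthen a trail. -/
theorem trail_sublist_le {d : ι → ι → ℝ} (ht : ∀ i j k, d i k ≤ d i j + d j k) (z : ι)
    {l₁ l₂ : List ι} (h : l₁.Sublist l₂) (a : ι) : trail d a z l₁ ≤ trail d a z l₂ := by
  induction h generalizing a with
  | slnil => exact le_rfl
  | cons x _ ih => exact (trail_le_add_left ht a x z _).trans (add_le_add le_rfl (ih x))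
  | cons_cons x _ ih => exact add_le_add le_rfl (ih x)

/-- A closed tour may be started at each of its points. -/
theorem exists_tour_rotate [AddCommSemigroup M] {x z : ι} {l : List ι} (hz : z ∈ x :: l) :
    ∃ l', (z :: l').Perm (x :: l) ∧ ∀ d : ι → ι → M, trail d z z l' = trail d x x l := by
  rcases List.mem_cons.1 hz with rfl | hz
  · exact ⟨l, List.Perm.refl _, fun _ => rfl⟩
  · obtain ⟨l₁, l₂, rfl⟩ := List.append_of_mem hz
    refine ⟨l₂ ++ x :: l₁, ?_, fun d => ?_⟩
    · exact (List.perm_append_comm (l₁ := z :: l₂) (l₂ := x :: l₁))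
    · rw [trail_append, trail_append, add_comm]

/-- A trail is additive in its distance function, so bounds on the integer crossing counts of each
level become a bound on the real length. -/
theorem trail_eq_sum_split {lam : ℝ} (h0 : 0 ≤ lam) (X : ι → Leaf b δ) (a z : ι) (l : List ι) :
    trail (fun i j => leafDist lam (X i) (X j)) a z l =
      ∑ ℓ ∈ Finset.Icc 1 δ, 2 * lam ^ ℓ * ((trail (split X ℓ) a z l : ℕ) : ℝ) := by
  induction l generalizing a with
  | nil => exact leafDist_eq_sum_split h0 X a z
  | cons y l ih =>
    simp only [trail, ih, leafDist_eq_sum_split h0 X a y, ← Finset.sum_add_distrib]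
    refine Finset.sum_congr rfl fun ℓ _ => ?_
    push_cast
    ring

theorem trail_ofFn [AddCommMonoid M] (d : ι → ι → M) {m : ℕ} (f : Fin (m + 1) → ι) (z : ι) :
    trail d (f 0) z (List.ofFn fun i : Fin m => f i.succ) =
      ∑ i : Fin m, d (f i.castSucc) (f i.succ) + d (f (Fin.last m)) z := by
  induction m with
  | zero => simp [trail]
  | succ m ih =>
    have h := ih fun i => f i.succ
    rw [List.ofFn_succ, trail]
    refine (congrArg (d (f 0) (f (Fin.succ 0)) + ·) h).trans ?_
    rw [Fin.sum_univ_succ (n := m)]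
    exact (add_assoc _ _ _).symm

end Trail

/-! ### Short structures on finitely many points of the tree -/

section Greedy

variable {ι : Type*} [DecidableEq ι]

/-- A set of points has a tour that enters every subtree at most once. -/
theorem exists_tour (X : ι → Leaf b δ) (U : Finset ι) (z : ι) (hz : z ∈ U) :
    ∃ l : List ι, (z :: l).Nodup ∧ (∀ i, i ∈ z :: l ↔ i ∈ U) ∧
      ∀ ℓ ≤ δ, trail (split X ℓ) z z l ≤ numClasses X ℓ U := by
  induction hn : U.card using Nat.strong_induction_on generalizing U z with
  | _ n ih =>
    by_cases hU : 1 < U.card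
    -- The point `y` is inserted right after `x` into a tour of the others. At levels that do not
    -- separate `x` and `y` the crossing count is unchanged; at the other levels all points lie in
    -- different subtrees, so the number of tour edges is already an admissible bound.
    · obtain ⟨x, hx, y, hy, hxy, hcl⟩ := exists_closest_pair X U hU
      obtain ⟨l, hl1, hl2, hl3⟩ := ih _ (by rw [← hn]; exact Finset.card_erase_lt_of_mem hy)
        (U.erase y) x (Finset.mem_erase.2 ⟨hxy, hx⟩) rfl
      have hy' : y ∉ x :: l := fun h => by simpa using (hl2 y).1 h
      have hp : (x :: y :: l).Perm (y :: x :: l) := List.Perm.swap _ _ _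
      have hnd : (x :: y :: l).Nodup := hp.nodup_iff.2 (List.nodup_cons.2 ⟨hy', hl1⟩)
      have hmem : ∀ i, i ∈ x :: y :: l ↔ i ∈ U := by
        intro i
        rw [hp.mem_iff, List.mem_cons, hl2, Finset.mem_erase]
        by_cases hi : i = y
        · simp [hi, hy]
        · simp [hi]
      obtain ⟨l', hl', htr⟩ := exists_tour_rotate (M := ℕ) ((hmem z).2 hz)
      refine ⟨l', hl'.nodup_iff.2 hnd, fun i => by rw [hl'.mem_iff, hmem], fun ℓ hℓ => ?_⟩
      rw [htr]
      by_cases hs : split X ℓ x y = 0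
      · have hxy' : pre ℓ (X x) = pre ℓ (X y) := by
          by_contra h
          simp [split, h] at hs
        have h1 : trail (split X ℓ) y x l = trail (split X ℓ) x x l :=
          trail_congr_left _ (fun j => by simp [split, hxy']) _ _
        rw [trail, hs, h1, zero_add]
        exact (hl3 ℓ hℓ).trans (numClasses_mono X ℓ (Finset.erase_subset _ _))
      · rw [numClasses_eq_card (hcl ℓ hℓ hs)]
        refine (trail_le_length _ (split_le_one X ℓ) _ _ _).trans ?_
        have h1 : (x :: y :: l).toFinset = U := by
          ext i
          rw [List.mem_toFinset, hmem]
        rw [← h1, List.toFinset_card_of_nodup hnd]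
        simp
    · have hU1 : U = {z} := Finset.eq_singleton_iff_unique_mem.2
        ⟨hz, fun w hw => Finset.card_le_one.1 (not_lt.1 hU) w hw z hz⟩
      refine ⟨[], by simp, by simp [hU1], fun ℓ _ => by simp [trail, split]⟩

/-- The number of points of `U` that are matched to a point of another subtree of level `ℓ` is
at most the number of these subtrees, for a suitable matching. -/
theorem exists_matching (X : ι → Leaf b δ) (U : Finset ι) :
    ∃ f : ι → ι, Function.Involutive f ∧ (∀ i, i ∉ U → f i = i) ∧
      (∀ i ∈ U, ∀ j ∈ U, f i = i → f j = j → i = j) ∧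
      ∀ ℓ ≤ δ, ∑ i ∈ U, split X ℓ i (f i) ≤ numClasses X ℓ U := by
  induction hn : U.card using Nat.strong_induction_on generalizing U with
  | _ n ih =>
    by_cases hU : 1 < U.card
    · obtain ⟨x, hx, y, hy, hxy, hcl⟩ := exists_closest_pair X U hU
      have hyU : y ∈ U.erase x := Finset.mem_erase.2 ⟨hxy.symm, hy⟩
      obtain ⟨g, hg1, hg2, hg3, hg4⟩ := ih _ (by
        rw [← hn]
        exact (Finset.card_erase_le).trans_lt (Finset.card_erase_lt_of_mem hx))
        ((U.erase x).erase y) rfl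
      have hgx : g x = x := hg2 x (by simp)
      have hgy : g y = y := hg2 y (by simp)
      have hgne : ∀ i, i ≠ x → i ≠ y → g i ≠ x ∧ g i ≠ y := fun i h1 h2 =>
        ⟨fun h => h1 (by rw [← hg1 i, h, hgx]), fun h => h2 (by rw [← hg1 i, h, hgy])⟩
      have hfi : ∀ i, i ≠ x → i ≠ y → (Equiv.swap x y) (g i) = g i := fun i h1 h2 =>
        Equiv.swap_apply_of_ne_of_ne (hgne i h1 h2).1 (hgne i h1 h2).2
      have hmem : ∀ i, i ≠ x → i ≠ y → i ∈ U → i ∈ (U.erase x).erase y := fun i h1 h2 h3 => by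
        simp [h1, h2, h3]
      refine ⟨fun i => Equiv.swap x y (g i), ?_, ?_, ?_, ?_⟩
      -- The involution `g` fixes `x` and `y`, so composing it with the transposition adds the
      -- single pair `{x, y}`.
      · intro i
        simp only
        by_cases h1 : i = x
        · simp [h1, hgx, hgy]
        by_cases h2 : i = y
        · simp [h2, hgx, hgy]
        rw [hfi i h1 h2, hfi _ (hgne i h1 h2).1 (hgne i h1 h2).2, hg1]
      · intro i hi
        have h1 : i ≠ x := fun h => hi (h ▸ hx)
        have h2 : i ≠ y := fun h => hi (h ▸ hy)
        simp only
        rw [hfi i h1 h2]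
        exact hg2 i fun h => hi (Finset.mem_of_mem_erase (Finset.mem_of_mem_erase h))
      · have key : ∀ i ∈ U, Equiv.swap x y (g i) = i → i ∈ (U.erase x).erase y ∧ g i = i := by
          intro i hi h
          have h1 : i ≠ x := fun h1 => by
            rw [h1, hgx, Equiv.swap_apply_left] at h
            exact hxy h.symm
          have h2 : i ≠ y := fun h2 => by
            rw [h2, hgy, Equiv.swap_apply_right] at h
            exact hxy h
          rw [hfi i h1 h2] at h
          exact ⟨hmem i h1 h2 hi, h⟩
        intro i hi j hj h1 h2
        exact hg3 i (key i hi h1).1 j (key j hj h2).1 (key i hi h1).2 (key j hj h2).2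
      · intro ℓ hℓ
        by_cases hs : split X ℓ x y = 0
        · have h1 : ∀ i ∈ (U.erase x).erase y,
              split X ℓ i (Equiv.swap x y (g i)) = split X ℓ i (g i) := by
            intro i hi
            simp only [Finset.mem_erase] at hi
            rw [hfi i hi.2.1 hi.1]
          rw [← Finset.add_sum_erase _ _ hx, ← Finset.add_sum_erase _ _ hyU,
            Finset.sum_congr rfl h1]
          simp only
          rw [hgx, hgy, Equiv.swap_apply_left, Equiv.swap_apply_right,
            split_comm X ℓ y x, hs, zero_add, zero_add]
          exact (hg4 ℓ hℓ).trans (numClasses_mono X ℓ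
            ((Finset.erase_subset _ _).trans (Finset.erase_subset _ _)))
        · rw [numClasses_eq_card (hcl ℓ hℓ hs), Finset.card_eq_sum_ones]
          exact Finset.sum_le_sum fun i _ => split_le_one X ℓ _ _
    · refine ⟨id, fun _ => rfl, fun _ _ => rfl, fun i hi j hj _ _ =>
        Finset.card_le_one.1 (not_lt.1 hU) i hi j hj, fun ℓ _ => by simp [split]⟩

/-- `split` as a function of the edge `{i, j}`. -/
def splitEdge (X : ι → Leaf b δ) (ℓ : ℕ) : Sym2 ι → ℕ :=
  Sym2.lift ⟨split X ℓ, split_comm X ℓ⟩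

/-- A set of points is connected by edges of which at most `N - 1` join different subtrees of
level `ℓ`, if the points lie in `N` of these subtrees. -/
theorem exists_connecting_edges (X : ι → Leaf b δ) (U : Finset ι) (hne : U.Nonempty) :
    ∃ E : Finset (Sym2 ι),
      (∀ u ∈ U, ∀ v ∈ U, (SimpleGraph.fromEdgeSet (E : Set (Sym2 ι))).Reachable u v) ∧
      ∀ ℓ ≤ δ, ∑ e ∈ E, splitEdge X ℓ e + 1 ≤ numClasses X ℓ U := by
  induction hn : U.card using Nat.strong_induction_on generalizing U with
  | _ n ih =>
    by_cases hU : 1 < U.card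
    · obtain ⟨x, hx, y, hy, hxy, hcl⟩ := exists_closest_pair X U hU
      have hxU : x ∈ U.erase y := Finset.mem_erase.2 ⟨hxy, hx⟩
      obtain ⟨E, hE1, hE2⟩ := ih _ (by rw [← hn]; exact Finset.card_erase_lt_of_mem hy)
        (U.erase y) ⟨x, hxU⟩ rfl
      refine ⟨insert s(x, y) E, ?_, fun ℓ hℓ => ?_⟩
      · have hle : SimpleGraph.fromEdgeSet (E : Set (Sym2 ι)) ≤
            SimpleGraph.fromEdgeSet ((insert s(x, y) E : Finset (Sym2 ι)) : Set (Sym2 ι)) :=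
          SimpleGraph.fromEdgeSet_mono (by simp)
        have hx' : ∀ u ∈ U, (SimpleGraph.fromEdgeSet
            ((insert s(x, y) E : Finset (Sym2 ι)) : Set (Sym2 ι))).Reachable x u := by
          intro u hu
          by_cases huy : u = y
          · rw [huy]
            exact SimpleGraph.Adj.reachable (by simp [SimpleGraph.fromEdgeSet_adj, hxy])
          · exact (hE1 x hxU u (Finset.mem_erase.2 ⟨huy, hu⟩)).mono hle
        exact fun u hu v hv => (hx' u hu).symm.trans (hx' v hv)
      · have h1 : ∑ e ∈ insert s(x, y) E, splitEdge X ℓ e ≤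
            split X ℓ x y + ∑ e ∈ E, splitEdge X ℓ e := by
          by_cases h : s(x, y) ∈ E
          · rw [Finset.insert_eq_of_mem h]
            omega
          · rw [Finset.sum_insert h]
            rfl
        have h2 := hE2 ℓ hℓ
        -- The new edge costs nothing where it does not cross. Where it crosses, all points are
        -- separated, so the bound for `U.erase y` is at most `U.card - 1` and leaves room for one
        -- more crossing.
        by_cases hs : split X ℓ x y = 0
        · have := numClasses_mono X ℓ (Finset.erase_subset y U)
          omega
        · have h3 := numClasses_le_card X ℓ (U.erase y)
          rw [Finset.card_erase_of_mem hy] at h3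
          have h4 := split_le_one X ℓ x y
          rw [numClasses_eq_card (hcl ℓ hℓ hs)]
          omega
    · obtain ⟨z, hz⟩ := hne
      refine ⟨∅, fun u hu v hv => ?_, fun ℓ _ => ?_⟩
      · rw [Finset.card_le_one.1 (not_lt.1 hU) u hu v hv]
      · rw [Finset.sum_empty, zero_add]
        exact Finset.card_pos.2 ⟨_, Finset.mem_image_of_mem _ hz⟩

end Greedy

/-! ### The levels of the tree -/

theorem Top_nonneg {lam : ℝ} (h0 : 0 ≤ lam) (k : ℕ) : 0 ≤ Top b δ lam k :=
  Finset.sum_nonneg fun _ _ => by positivity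

/-- With `c = ⌈log_b k⌉`, the levels up to `c` contribute at most `Top`. The deeper ones contribute
at most `2 * k * lam ^ (c + 1) / (1 - lam)`, and `k * lam ^ c ≤ b ^ c * lam ^ c` is bounded by the
last term of `Top`. Together this is `(1 + lam) / (1 - lam)` times `Top`. -/
theorem sum_levels_le {lam : ℝ} (h0 : 0 < lam) (h1 : lam < 1) (hb : 2 ≤ b) {k : ℕ} (hk : 2 ≤ k)
    {N : ℕ → ℝ} (hN1 : ∀ ℓ, N ℓ ≤ (b : ℝ) ^ ℓ) (hN2 : ∀ ℓ, N ℓ ≤ 2 * k) :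
    ∑ ℓ ∈ Finset.Icc 1 δ, lam ^ ℓ * N ℓ ≤ 2 * Top b δ lam k / (1 - lam) := by
  have h2 : 0 < 1 - lam := sub_pos.2 h1
  have hT := Top_nonneg (b := b) (δ := δ) h0.le k
  rw [le_div_iff₀ h2]
  have hlow : ∀ m, ∑ ℓ ∈ Finset.Icc 1 m, lam ^ ℓ * N ℓ ≤
      ∑ ℓ ∈ Finset.Icc 1 m, (b : ℝ) ^ ℓ * lam ^ ℓ := fun m => Finset.sum_le_sum fun ℓ _ => by
    rw [mul_comm]
    exact mul_le_mul_of_nonneg_right (hN1 ℓ) (by positivity)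
  set c := Nat.clog b k with hc
  by_cases hcδ : δ ≤ c
  · have h3 : ∑ ℓ ∈ Finset.Icc 1 δ, lam ^ ℓ * N ℓ ≤ Top b δ lam k := by
      unfold Top
      rw [← hc, min_eq_left hcδ]
      exact hlow δ
    nlinarith
  · push Not at hcδ
    have hTc : Top b δ lam k = ∑ ℓ ∈ Finset.Icc 1 c, (b : ℝ) ^ ℓ * lam ^ ℓ := by
      unfold Top
      rw [← hc, min_eq_right hcδ.le]
    have hc1 : 1 ≤ c := Nat.clog_pos (by omega) hk
    have hbc : (b : ℝ) ^ c * lam ^ c ≤ Top b δ lam k := by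
      rw [hTc]
      exact Finset.single_le_sum (f := fun ℓ : ℕ => (b : ℝ) ^ ℓ * lam ^ ℓ)
        (fun _ _ => by positivity) (Finset.mem_Icc.2 ⟨hc1, le_rfl⟩)
    have hkb : (k : ℝ) ≤ (b : ℝ) ^ c := by
      exact_mod_cast Nat.le_pow_clog (by omega) k
    have hsplit : ∑ ℓ ∈ Finset.Icc 1 δ, lam ^ ℓ * N ℓ =
        ∑ ℓ ∈ Finset.Icc 1 c, lam ^ ℓ * N ℓ + ∑ ℓ ∈ Finset.Ioc c δ, lam ^ ℓ * N ℓ := by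
      rw [← Finset.sum_union]
      · congr 1
        ext ℓ
        simp only [Finset.mem_union, Finset.mem_Icc, Finset.mem_Ioc]
        omega
      · rw [Finset.disjoint_left]
        intro ℓ
        simp only [Finset.mem_Icc, Finset.mem_Ioc]
        omega
    have htail : ∀ m, c ≤ m → (1 - lam) * ∑ ℓ ∈ Finset.Ioc c m, lam ^ ℓ ≤ lam ^ (c + 1) := by
      intro m hm
      have h5 : (1 - lam) * ∑ ℓ ∈ Finset.Ioc c m, lam ^ ℓ = lam ^ (c + 1) - lam ^ (m + 1) := by
        induction m, hm using Nat.le_induction with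
        | base => simp
        | succ m hm ih =>
          rw [Finset.sum_Ioc_succ_top hm, mul_add, ih]
          ring
      rw [h5]
      linarith [pow_pos h0 (m + 1)]
    have hhigh : ∑ ℓ ∈ Finset.Ioc c δ, lam ^ ℓ * N ℓ ≤ 2 * k * ∑ ℓ ∈ Finset.Ioc c δ, lam ^ ℓ := by
      rw [Finset.mul_sum]
      refine Finset.sum_le_sum fun ℓ _ => ?_
      rw [mul_comm]
      exact mul_le_mul_of_nonneg_right (hN2 ℓ) (by positivity)
    have h6 : (∑ ℓ ∈ Finset.Ioc c δ, lam ^ ℓ * N ℓ) * (1 - lam) ≤ 2 * lam * Top b δ lam k := by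
      calc (∑ ℓ ∈ Finset.Ioc c δ, lam ^ ℓ * N ℓ) * (1 - lam)
          ≤ (2 * k * ∑ ℓ ∈ Finset.Ioc c δ, lam ^ ℓ) * (1 - lam) :=
            mul_le_mul_of_nonneg_right hhigh h2.le
        _ = 2 * k * ((1 - lam) * ∑ ℓ ∈ Finset.Ioc c δ, lam ^ ℓ) := by ring
        _ ≤ 2 * k * lam ^ (c + 1) := mul_le_mul_of_nonneg_left (htail δ hcδ.le) (by positivity)
        _ ≤ 2 * (b : ℝ) ^ c * lam ^ (c + 1) := by gcongr
        _ = 2 * lam * ((b : ℝ) ^ c * lam ^ c) := by ring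
        _ ≤ 2 * lam * Top b δ lam k := mul_le_mul_of_nonneg_left hbc (by positivity)
    have h7 := hlow c
    rw [← hTc] at h7
    rw [hsplit, add_mul]
    nlinarith

/-! ### Tours -/

theorem sum_finRotate_eq_trail {ι M : Type*} [AddCommMonoid M] (d : ι → ι → M) {m : ℕ}
    (f : Fin (m + 1) → ι) :
    ∑ i, d (f i) (f (finRotate (m + 1) i)) =
      trail d (f 0) (f 0) (List.ofFn fun i : Fin m => f i.succ) := by
  rw [trail_ofFn, Fin.sum_univ_castSucc, finRotate_last]
  congr 1
  refine Finset.sum_congr rfl fun i _ => ?_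
  rw [finRotate_apply, Fin.coeSucc_eq_succ]

theorem tspCost_le {lam : ℝ} (h0 : 0 ≤ lam) (X : Fin n → Leaf b δ) {z : Fin n} {l : List (Fin n)}
    (hnd : (z :: l).Nodup) (hl : ∀ i, i ∈ z :: l) :
    tspCost lam X ≤ trail (fun i j => leafDist lam (X i) (X j)) z z l := by
  refine csInf_le ⟨0, ?_⟩ ?_
  · rintro _ ⟨σ, rfl⟩
    exact Finset.sum_nonneg fun i _ => leafDist_nonneg h0 _ _
  · set e := List.Nodup.getEquivOfForallMemList (z :: l) hnd hl with he
    have hlen : (z :: l).length = n := by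
      simpa using Fintype.card_congr e
    obtain ⟨m, rfl⟩ : ∃ m, n = m + 1 := ⟨l.length, hlen.symm⟩
    refine ⟨(finCongr hlen.symm).trans e, ?_⟩
    rw [sum_finRotate_eq_trail (fun i j => leafDist lam (X i) (X j))]
    have h1 : ((finCongr hlen.symm).trans e) 0 = z := rfl
    have h2 : (List.ofFn fun i : Fin m => ((finCongr hlen.symm).trans e) i.succ) = l := by
      refine List.ext_getElem (by simpa using hlen.symm) fun i h3 h4 => ?_
      rw [List.getElem_ofFn]
      rfl
    rw [h1, h2]

theorem exists_tspCost_eq (lam : ℝ) (Y : Fin n → Leaf b δ) (z : Fin n) :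
    ∃ l : List (Fin n), (z :: l).Nodup ∧ (∀ i, i ∈ z :: l) ∧
      trail (fun i j => leafDist lam (Y i) (Y j)) z z l = tspCost lam Y := by
  obtain ⟨m, rfl⟩ : ∃ m, n = m + 1 := ⟨n - 1, by have := z.2; omega⟩
  have hfin : {c : ℝ | ∃ σ : Equiv.Perm (Fin (m + 1)), c = ∑ i : Fin (m + 1),
      leafDist lam (Y (σ i)) (Y (σ (finRotate (m + 1) i)))}.Finite := by
    refine (Set.finite_range fun σ : Equiv.Perm (Fin (m + 1)) => ∑ i : Fin (m + 1),
      leafDist lam (Y (σ i)) (Y (σ (finRotate (m + 1) i)))).subset ?_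
    rintro _ ⟨σ, rfl⟩
    exact ⟨σ, rfl⟩
  have hne : {c : ℝ | ∃ σ : Equiv.Perm (Fin (m + 1)), c = ∑ i : Fin (m + 1),
      leafDist lam (Y (σ i)) (Y (σ (finRotate (m + 1) i)))}.Nonempty := ⟨_, 1, rfl⟩
  obtain ⟨σ, hσ⟩ := hne.csInf_mem hfin
  have h1 : (σ 0 :: List.ofFn fun i : Fin m => σ i.succ) = List.ofFn σ := by
    rw [List.ofFn_succ]
  have h2 : ∀ i, i ∈ (σ 0 :: List.ofFn fun i : Fin m => σ i.succ) := fun i => by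
    rw [h1, List.mem_ofFn]
    exact σ.surjective i
  obtain ⟨l', hp, htr⟩ := exists_tour_rotate (M := ℝ) (h2 z)
  refine ⟨l', ?_, fun i => hp.mem_iff.2 (h2 i), ?_⟩
  · rw [hp.nodup_iff, h1]
    exact List.nodup_ofFn.2 σ.injective
  · rw [htr, ← sum_finRotate_eq_trail (fun i j => leafDist lam (Y i) (Y j)) σ]
    exact hσ.symm

/-- A tour through few points is short. -/
theorem exists_short_tour {lam : ℝ} (h0 : 0 < lam) (h1 : lam < 1) (hb : 2 ≤ b) {k : ℕ}
    (hk : 2 ≤ k) (X : Fin n → Leaf b δ) (U : Finset (Fin n)) (hU : U.card ≤ 2 * k) {z : Fin n}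
    (hz : z ∈ U) :
    ∃ l : List (Fin n), (z :: l).Nodup ∧ (∀ i, i ∈ z :: l ↔ i ∈ U) ∧
      trail (fun i j => leafDist lam (X i) (X j)) z z l ≤ 8 * Top b δ lam k / (1 - lam) := by
  obtain ⟨l, hnd, hl, htr⟩ := exists_tour X U z hz
  refine ⟨l, hnd, hl, ?_⟩
  rw [trail_eq_sum_split h0.le]
  have h2 := sum_levels_le (δ := δ) h0 h1 hb hk (N := fun ℓ => (numClasses X ℓ U : ℝ))
    (fun ℓ => by exact_mod_cast numClasses_le_pow (by omega) X ℓ U)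
    (fun ℓ => by exact_mod_cast (numClasses_le_card X ℓ U).trans hU)
  have h3 : ∑ ℓ ∈ Finset.Icc 1 δ, 2 * lam ^ ℓ * ((trail (split X ℓ) z z l : ℕ) : ℝ) ≤
      2 * ∑ ℓ ∈ Finset.Icc 1 δ, lam ^ ℓ * (numClasses X ℓ U : ℝ) := by
    rw [Finset.mul_sum]
    refine Finset.sum_le_sum fun ℓ hℓ => ?_
    rw [mul_assoc]
    have : ((trail (split X ℓ) z z l : ℕ) : ℝ) ≤ numClasses X ℓ U := by
      exact_mod_cast htr ℓ (Finset.mem_Icc.1 hℓ).2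
    gcongr
  -- The argument gives the constant 4; the rest is slack.
  have h4 : 8 * Top b δ lam k / (1 - lam) = 4 * (2 * Top b δ lam k / (1 - lam)) := by ring
  have h5 : 0 ≤ 2 * Top b δ lam k / (1 - lam) :=
    div_nonneg (mul_nonneg (by norm_num) (Top_nonneg h0.le k)) (sub_pos.2 h1).le
  rw [h4]
  linarith

/-- Two closed tours are joined at an unchanged point `z`: a short one through `z` and the changed
points, and the optimal tour of `Y` shortcut to the unchanged points. -/
theorem isSmooth_tspCost (hb : 2 ≤ b) (hn : 1 ≤ n) {lam : ℝ} (h0 : 0 < lam) (h1 : lam < 1) :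
    IsSmooth lam 8 (tspCost lam : (Fin n → Leaf b δ) → ℝ) := by
  intro X Y k hk hH
  set dX : Fin n → Fin n → ℝ := fun i j => leafDist lam (X i) (X j) with hdX
  set dY : Fin n → Fin n → ℝ := fun i j => leafDist lam (Y i) (Y j) with hdY
  have htri : ∀ i j k, dX i k ≤ dX i j + dX j k := fun i j k => leafDist_triangle h0.le _ _ _
  have htriY : ∀ i j k, dY i k ≤ dY i j + dY j k := fun i j k => leafDist_triangle h0.le _ _ _
  set S : Finset (Fin n) := Finset.univ.filter fun i => X i ≠ Y i with hS
  have hSk : S.card ≤ k := hH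
  by_cases hz : ∃ z, X z = Y z
  · obtain ⟨z, hz⟩ := hz
    obtain ⟨l, hnd, hl, hY⟩ := exists_tspCost_eq lam Y z
    -- Here `k + 1 ≤ 2 * k`.
    have hcard : (insert z S).card ≤ 2 * k := (Finset.card_insert_le _ _).trans (by omega)
    obtain ⟨T, hTnd, hT, hTX⟩ := exists_short_tour h0 h1 hb hk X (insert z S) hcard
      (Finset.mem_insert_self z S)
    set r := l.filter fun i => X i = Y i with hr
    have hmemT : ∀ i, i ∈ T → X i ≠ Y i := by
      intro i hi
      have h2 := (hT i).1 (List.mem_cons_of_mem _ hi)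
      have h3 : i ≠ z := fun h => (List.nodup_cons.1 hTnd).1 (h ▸ hi)
      simpa [hS, h3] using h2
    have hmemr : ∀ i, i ∈ r → i ∈ l ∧ X i = Y i := fun i hi => by
      simpa [hr] using hi
    have hnd' : (z :: (T ++ r)).Nodup := by
      rw [List.nodup_cons, List.nodup_append]
      refine ⟨?_, (List.nodup_cons.1 hTnd).2, (List.nodup_cons.1 hnd).2.filter _, ?_⟩
      · rw [List.mem_append]
        rintro (h | h)
        · exact (List.nodup_cons.1 hTnd).1 h
        · exact (List.nodup_cons.1 hnd).1 (hmemr z h).1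
      · rintro i hi j hj rfl
        exact hmemT i hi (hmemr i hj).2
    have hall : ∀ i, i ∈ z :: (T ++ r) := by
      intro i
      rw [List.mem_cons, List.mem_append]
      by_cases hiz : i = z
      · exact Or.inl hiz
      refine Or.inr ?_
      by_cases hi : X i = Y i
      · right
        have := hl i
        simp only [List.mem_cons, hiz, false_or] at this
        simp [hr, this, hi]
      · left
        have := (hT i).2 (by simp [hS, hi])
        simpa [hiz] using this
    have hr1 : trail dX z z r = trail dY z z r :=
      trail_congr dX dY (fun i => X i = Y i)
        (fun i j hi hj => by simp only [hdX, hdY, hi, hj]) hz hz fun i hi => (hmemr i hi).2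
    have hr2 : trail dY z z r ≤ trail dY z z l := trail_sublist_le htriY z List.filter_sublist z
    have hr3 := trail_append_le htri z z z T r
    have hle := tspCost_le h0.le X hnd' hall
    linarith
  -- If every point changes then `n ≤ k`, and a short tour through all points suffices.
  · push Not at hz
    have hU : (Finset.univ : Finset (Fin n)).card ≤ 2 * k := by
      have : S = Finset.univ := by
        rw [hS, Finset.filter_true_of_mem]
        exact fun i _ => hz i
      rw [← this]
      omega
    obtain ⟨T, hTnd, hT, hTX⟩ := exists_short_tour h0 h1 hb hk X Finset.univ hU
      (Finset.mem_univ (⟨0, hn⟩ : Fin n))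
    have hle := tspCost_le h0.le X hTnd fun i => (hT i).2 (Finset.mem_univ i)
    obtain ⟨l, -, -, hY⟩ := exists_tspCost_eq lam Y ⟨0, hn⟩
    have hY0 : 0 ≤ tspCost lam Y := by
      rw [← hY]
      exact trail_nonneg (fun i j => leafDist_nonneg h0.le _ _) _ _ _
    linarith

/-! ### Spanning trees -/

theorem pairWeight_eq_sum_splitEdge {lam : ℝ} (h0 : 0 ≤ lam) (X : Fin n → Leaf b δ)
    (e : Sym2 (Fin n)) :
    pairWeight lam X e = ∑ ℓ ∈ Finset.Icc 1 δ, 2 * lam ^ ℓ * (splitEdge X ℓ e : ℝ) := by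
  induction e with
  | _ i j => exact leafDist_eq_sum_split h0 X i j

theorem pairWeight_nonneg {lam : ℝ} (h0 : 0 ≤ lam) (X : Fin n → Leaf b δ) (e : Sym2 (Fin n)) :
    0 ≤ pairWeight lam X e := by
  induction e with
  | _ i j => exact leafDist_nonneg h0 _ _

theorem sum_pairWeight_eq {lam : ℝ} (h0 : 0 ≤ lam) (X : Fin n → Leaf b δ)
    (E : Finset (Sym2 (Fin n))) :
    ∑ e ∈ E, pairWeight lam X e =
      ∑ ℓ ∈ Finset.Icc 1 δ, 2 * lam ^ ℓ * ((∑ e ∈ E, splitEdge X ℓ e : ℕ) : ℝ) := by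
  simp only [pairWeight_eq_sum_splitEdge h0]
  rw [Finset.sum_comm]
  refine Finset.sum_congr rfl fun ℓ _ => ?_
  rw [Nat.cast_sum, Finset.mul_sum]

-- Contracting each subtree of level `ℓ` leaves a connected graph on the occupied subtrees. It has
-- at least one edge fewer than vertices, and each of its edges comes from a crossing edge of `F`.
open Classical in
theorem numClasses_le_of_connected (X : Fin n → Leaf b δ) (ℓ : ℕ) {F : SimpleGraph (Fin n)}
    (hF : F.Connected) :
    numClasses X ℓ Finset.univ ≤
      ∑ e : Sym2 (Fin n) with e ∈ F.edgeSet, splitEdge X ℓ e + 1 := by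
  set W : Finset (Fin (min ℓ δ) → Fin b) := Finset.univ.image fun i => pre ℓ (X i) with hW
  set p : Fin n → W := fun i =>
    ⟨pre ℓ (X i), Finset.mem_image_of_mem (fun i => pre ℓ (X i)) (Finset.mem_univ i)⟩ with hp
  have hpsurj : Function.Surjective p := by
    rintro ⟨w, hw⟩
    obtain ⟨i, -, rfl⟩ := Finset.mem_image.1 hw
    exact ⟨i, rfl⟩
  set H : SimpleGraph W := SimpleGraph.fromEdgeSet (Sym2.map p '' F.edgeSet) with hH
  have hreach : ∀ {i j}, F.Walk i j → H.Reachable (p i) (p j) := by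
    intro i j q
    induction q with
    | nil => exact SimpleGraph.Reachable.refl _
    | @cons u v w h q ih =>
      refine SimpleGraph.Reachable.trans ?_ ih
      by_cases huv : p u = p v
      · rw [huv]
      · refine SimpleGraph.Adj.reachable ?_
        rw [hH, SimpleGraph.fromEdgeSet_adj]
        exact ⟨⟨s(u, v), h, rfl⟩, huv⟩
  have hHc : H.Connected := by
    have : Nonempty W := hF.nonempty.map p
    refine ⟨fun u v => ?_⟩
    obtain ⟨i, rfl⟩ := hpsurj u
    obtain ⟨j, rfl⟩ := hpsurj v
    exact (hF.preconnected i j).elim hreach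
  have h1 := hHc.card_vert_le_card_edgeSet_add_one
  have h2 : Nat.card W = numClasses X ℓ Finset.univ := by
    rw [Nat.card_eq_fintype_card, Fintype.card_coe]
    rfl
  have h3 : Nat.card H.edgeSet ≤ ∑ e : Sym2 (Fin n) with e ∈ F.edgeSet, splitEdge X ℓ e := by
    set E : Finset (Sym2 (Fin n)) :=
      (Finset.univ.filter fun e => e ∈ F.edgeSet).filter fun e => splitEdge X ℓ e ≠ 0 with hE
    have h4 : H.edgeSet ⊆ ((E.image (Sym2.map p) : Finset (Sym2 W)) : Set (Sym2 W)) := by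
      intro e he
      rw [hH, SimpleGraph.edgeSet_fromEdgeSet] at he
      obtain ⟨⟨e', he', rfl⟩, hd⟩ := he
      rw [Finset.mem_coe]
      refine Finset.mem_image_of_mem _ ?_
      simp only [hE, Finset.mem_filter, Finset.mem_univ, true_and]
      refine ⟨he', ?_⟩
      induction e' with
      | _ i j =>
        have : pre ℓ (X i) ≠ pre ℓ (X j) := by
          intro h
          refine hd ?_
          simp [hp, h]
        simp [splitEdge, split, this]
    calc Nat.card H.edgeSet ≤ (E.image (Sym2.map p)).card := by
          rw [Nat.card_coe_set_eq, ← Set.ncard_coe_finset]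
          exact Set.ncard_le_ncard h4 (Finset.finite_toSet _)
      _ ≤ E.card := Finset.card_image_le
      _ = ∑ e ∈ E, 1 := Finset.card_eq_sum_ones E
      _ ≤ ∑ e ∈ E, splitEdge X ℓ e := Finset.sum_le_sum fun e he => by
          have := (Finset.mem_filter.1 he).2
          omega
      _ ≤ _ := Finset.sum_le_sum_of_subset (Finset.filter_subset _ _)
  omega

/-- The cost of a minimum spanning tree in terms of the numbers of subtrees that contain
points. -/
theorem mstCost_eq {lam : ℝ} (h0 : 0 ≤ lam) (hn : 1 ≤ n) (X : Fin n → Leaf b δ) :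
    mstCost lam X =
      ∑ ℓ ∈ Finset.Icc 1 δ, 2 * lam ^ ℓ * ((numClasses X ℓ Finset.univ : ℝ) - 1) := by
  classical
  have : Nonempty (Fin n) := ⟨⟨0, hn⟩⟩
  obtain ⟨E, hE1, hE2⟩ := exists_connecting_edges X Finset.univ Finset.univ_nonempty
  have hc : (SimpleGraph.fromEdgeSet (E : Set (Sym2 (Fin n)))).Connected :=
    ⟨fun u v => hE1 u (Finset.mem_univ u) v (Finset.mem_univ v)⟩
  -- The connecting edges need not form a tree; a spanning subtree drops edges of nonnegative
  -- weight.
  obtain ⟨T, hT, hTt⟩ := hc.exists_isTree_le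
  apply le_antisymm
  · have hle : mstCost lam X ≤ ∑ e : Sym2 (Fin n) with e ∈ T.edgeSet, pairWeight lam X e := by
      refine csInf_le ⟨0, ?_⟩ ⟨T, hTt, by congr!⟩
      rintro _ ⟨F, -, rfl⟩
      exact Finset.sum_nonneg fun e _ => pairWeight_nonneg h0 X e
    · refine hle.trans ((Finset.sum_le_sum_of_subset_of_nonneg (t := E) ?_
        fun e _ _ => pairWeight_nonneg h0 X e).trans ?_)
      · intro e he
        have h1 := SimpleGraph.edgeSet_mono hT (Finset.mem_filter.1 he).2
        rw [SimpleGraph.edgeSet_fromEdgeSet] at h1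
        exact h1.1
      · rw [sum_pairWeight_eq h0]
        refine Finset.sum_le_sum fun ℓ hℓ => ?_
        refine mul_le_mul_of_nonneg_left ?_ (by positivity)
        rw [le_sub_iff_add_le]
        exact_mod_cast hE2 ℓ (Finset.mem_Icc.1 hℓ).2
  · refine le_csInf ⟨_, T, hTt, rfl⟩ ?_
    rintro _ ⟨F, hF, rfl⟩
    rw [sum_pairWeight_eq h0]
    refine Finset.sum_le_sum fun ℓ _ => ?_
    refine mul_le_mul_of_nonneg_left ?_ (by positivity)
    rw [sub_le_iff_le_add]
    have := numClasses_le_of_connected X ℓ hF.connected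
    exact_mod_cast this

theorem isSmooth_mstCost (hb : 2 ≤ b) (hn : 1 ≤ n) {lam : ℝ} (h0 : 0 < lam) (h1 : lam < 1) :
    IsSmooth lam 4 (mstCost lam : (Fin n → Leaf b δ) → ℝ) := by
  intro X Y k hk hH
  set S : Finset (Fin n) := Finset.univ.filter fun i => X i ≠ Y i with hS
  have hSk : S.card ≤ k := hH
  have hN : ∀ ℓ, numClasses X ℓ Finset.univ ≤ numClasses Y ℓ Finset.univ + numClasses X ℓ S := by
    intro ℓ
    unfold numClasses
    refine (Finset.card_le_card ?_).trans (Finset.card_union_le _ _)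
    intro w hw
    obtain ⟨i, -, rfl⟩ := Finset.mem_image.1 hw
    by_cases hi : X i = Y i
    · refine Finset.mem_union_left _ (Finset.mem_image.2 ⟨i, Finset.mem_univ _, ?_⟩)
      rw [hi]
    · exact Finset.mem_union_right _ (Finset.mem_image_of_mem _ (by simp [hS, hi]))
  have h2 := sum_levels_le (δ := δ) h0 h1 hb hk (N := fun ℓ => (numClasses X ℓ S : ℝ))
    (fun ℓ => by exact_mod_cast numClasses_le_pow (by omega) X ℓ S)
    (fun ℓ => by
      have := (numClasses_le_card X ℓ S).trans hSk
      have : numClasses X ℓ S ≤ 2 * k := by omega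
      exact_mod_cast this)
  rw [mstCost_eq h0.le hn, mstCost_eq h0.le hn]
  have h3 : 4 * Top b δ lam k / (1 - lam) = 2 * (2 * Top b δ lam k / (1 - lam)) := by ring
  have h4 : ∑ ℓ ∈ Finset.Icc 1 δ, 2 * lam ^ ℓ * ((numClasses X ℓ Finset.univ : ℝ) - 1) ≤
      ∑ ℓ ∈ Finset.Icc 1 δ, 2 * lam ^ ℓ * ((numClasses Y ℓ Finset.univ : ℝ) - 1) +
        2 * ∑ ℓ ∈ Finset.Icc 1 δ, lam ^ ℓ * (numClasses X ℓ S : ℝ) := by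
    rw [Finset.mul_sum, ← Finset.sum_add_distrib]
    refine Finset.sum_le_sum fun ℓ _ => ?_
    have h5 : (numClasses X ℓ Finset.univ : ℝ) ≤
        numClasses Y ℓ Finset.univ + numClasses X ℓ S := by exact_mod_cast hN ℓ
    have h6 : 0 ≤ 2 * lam ^ ℓ := by positivity
    have h7 := mul_le_mul_of_nonneg_left h5 h6
    linarith
  rw [h3]
  linarith

/-! ### Matchings -/

/-- The moved points come in pairs. This parity is what makes an involution with at most one fixed
point a full matching. -/
theorem card_modEq_card_fixed {f : Fin n → Fin n} (hf : Function.Involutive f) :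
    n ≡ (Finset.univ.filter fun i => f i = i).card [MOD 2] := by
  have h := Equiv.Perm.card_compl_support_modEq (p := 2) (n := 1) (σ := hf.toPerm f) (by
    ext i
    simp [pow_two, hf i])
  rw [Fintype.card_fin] at h
  have h2 : (hf.toPerm f).supportᶜ = Finset.univ.filter fun i => f i = i := by
    ext i
    simp
  rw [h2] at h
  exact h.symm

-- Every edge is counted from both of its ends, and fixed points contribute distance zero.
open Classical in
theorem sum_edges_eq_sum_involution {lam : ℝ} (h0 : 0 ≤ lam) (X : Fin n → Leaf b δ)
    (M : (⊤ : SimpleGraph (Fin n)).Subgraph) {f : Fin n → Fin n} (hf : Function.Involutive f)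
    (hM : ∀ i j, M.Adj i j ↔ i ≠ j ∧ f i = j) :
    ∑ e : Sym2 (Fin n) with e ∈ M.edgeSet, pairWeight lam X e =
      (∑ i, leafDist lam (X i) (X (f i))) / 2 := by
  set V : Finset (Fin n) := Finset.univ.filter fun i => f i ≠ i with hV
  have h1 : ∑ i, leafDist lam (X i) (X (f i)) = ∑ i ∈ V, leafDist lam (X i) (X (f i)) := by
    symm
    refine Finset.sum_subset (Finset.subset_univ _) fun i _ hi => ?_
    have : f i = i := by simpa [hV] using hi
    rw [this, leafDist_self h0]
  have hmaps : ∀ i ∈ V, s(i, f i) ∈ Finset.univ.filter fun e => e ∈ M.edgeSet := by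
    intro i hi
    simp only [hV, Finset.mem_filter, Finset.mem_univ, true_and] at hi
    simp only [Finset.mem_filter, Finset.mem_univ, true_and, SimpleGraph.Subgraph.mem_edgeSet]
    exact (hM _ _).2 ⟨Ne.symm hi, rfl⟩
  rw [h1, ← Finset.sum_fiberwise_of_maps_to hmaps, eq_div_iff two_ne_zero, Finset.sum_mul]
  refine Finset.sum_congr rfl fun e he => ?_
  induction e with
  | _ i j =>
    simp only [Finset.mem_filter, Finset.mem_univ, true_and,
      SimpleGraph.Subgraph.mem_edgeSet] at he
    obtain ⟨hij, hfi⟩ := (hM _ _).1 he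
    have hfj : f j = i := by rw [← hfi, hf]
    have h2 : V.filter (fun x => s(x, f x) = s(i, j)) = {i, j} := by
      ext x
      simp only [hV, Finset.mem_filter, Finset.mem_univ, true_and, Finset.mem_insert,
        Finset.mem_singleton, Sym2.eq_iff]
      constructor
      · rintro ⟨-, ⟨h, -⟩ | ⟨h, -⟩⟩
        exacts [Or.inl h, Or.inr h]
      · rintro (rfl | rfl)
        · exact ⟨by rw [hfi]; exact hij.symm, Or.inl ⟨rfl, hfi⟩⟩
        · exact ⟨by rw [hfj]; exact hij, Or.inr ⟨rfl, hfj⟩⟩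
    rw [h2, Finset.sum_pair hij, hfi, hfj, leafDist_comm lam (X j) (X i), mul_two]
    rfl

/-- The matching whose edges join the points that are exchanged by an involution. -/
def matchingOf (f : Fin n → Fin n) (hf : Function.Involutive f) :
    (⊤ : SimpleGraph (Fin n)).Subgraph where
  verts := {i | f i ≠ i}
  Adj i j := i ≠ j ∧ f i = j
  adj_sub h := h.1
  edge_vert {i j} h := by
    rw [Set.mem_ofPred_eq, h.2]
    exact h.1.symm
  symm := ⟨fun i j h => ⟨h.1.symm, by rw [← h.2, hf]⟩⟩

theorem isFullMatching_matchingOf {f : Fin n → Fin n} (hf : Function.Involutive f)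
    (hfix : ∀ i j, f i = i → f j = j → i = j) : IsFullMatching (matchingOf f hf) := by
  have hmod := card_modEq_card_fixed hf
  unfold Nat.ModEq at hmod
  have hc : (Finset.univ.filter fun i => f i = i).card ≤ 1 :=
    Finset.card_le_one.2 fun i hi j hj =>
      hfix i j (Finset.mem_filter.1 hi).2 (Finset.mem_filter.1 hj).2
  refine ⟨fun i hi => ⟨f i, ⟨Ne.symm hi, rfl⟩, fun j hj => hj.2.symm⟩, fun hn => ?_, fun hn => ?_⟩
  · have h1 : (Finset.univ.filter fun i => f i = i).card = 0 := by
      have := Nat.even_iff.1 hn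
      omega
    refine Set.eq_univ_of_forall fun i hi => ?_
    have : i ∈ Finset.univ.filter fun i => f i = i := by simpa using hi
    rw [Finset.card_eq_zero.1 h1] at this
    simp at this
  · have h1 : (Finset.univ.filter fun i => f i = i).card = 1 := by
      have := Nat.odd_iff.1 hn
      omega
    obtain ⟨v, hv⟩ := Finset.card_eq_one.1 h1
    refine ⟨v, ?_⟩
    ext i
    have := Finset.ext_iff.1 hv i
    simp only [Finset.mem_filter, Finset.mem_univ, true_and, Finset.mem_singleton] at this
    exact not_congr this

theorem matchingCost_le {lam : ℝ} (h0 : 0 ≤ lam) (X : Fin n → Leaf b δ) {f : Fin n → Fin n}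
    (hf : Function.Involutive f) (hfix : ∀ i j, f i = i → f j = j → i = j) :
    matchingCost lam X ≤ (∑ i, leafDist lam (X i) (X (f i))) / 2 := by
  classical
  have hle : matchingCost lam X ≤
      ∑ e : Sym2 (Fin n) with e ∈ (matchingOf f hf).edgeSet, pairWeight lam X e := by
    refine csInf_le ⟨0, ?_⟩ ⟨_, isFullMatching_matchingOf hf hfix, by congr!⟩
    rintro _ ⟨M', -, rfl⟩
    exact Finset.sum_nonneg fun e _ => pairWeight_nonneg h0 X e
  exact hle.trans (sum_edges_eq_sum_involution h0 X _ hf fun i j => Iff.rfl).le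

theorem exists_involutive_subsingleton_fixed (X : Fin n → Leaf b δ) :
    ∃ f : Fin n → Fin n, Function.Involutive f ∧ ∀ i j, f i = i → f j = j → i = j := by
  obtain ⟨f, hf, -, hfix, -⟩ := exists_matching X Finset.univ
  exact ⟨f, hf, fun i j => hfix i (Finset.mem_univ _) j (Finset.mem_univ _)⟩

/-- The involution that exchanges the ends of the edges of a matching. -/
theorem exists_involution_of_isMatching {M : (⊤ : SimpleGraph (Fin n)).Subgraph}
    (hM : M.IsMatching) :
    ∃ f : Fin n → Fin n, Function.Involutive f ∧ (∀ i, f i = i ↔ i ∉ M.verts) ∧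
      ∀ i j, M.Adj i j ↔ i ≠ j ∧ f i = j := by
  classical
  have hadj : ∀ i j, M.Adj i j → i ≠ j := fun i j h => h.adj_sub
  set f : Fin n → Fin n := fun i => if h : i ∈ M.verts then (hM h).choose else i with hf
  have hf1 : ∀ i, i ∈ M.verts → M.Adj i (f i) := fun i hi => by
    simp only [hf, hi, dif_pos]
    exact (hM hi).choose_spec.1
  have hf2 : ∀ i, i ∉ M.verts → f i = i := fun i hi => by simp [hf, hi]
  have hf3 : ∀ i j, M.Adj i j → f i = j := fun i j h =>
    (hM (M.edge_vert h)).unique (hf1 i (M.edge_vert h)) h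
  refine ⟨f, fun i => ?_, fun i => ⟨fun h hi => ?_, hf2 i⟩, fun i j =>
    ⟨fun h => ⟨hadj i j h, hf3 i j h⟩, ?_⟩⟩
  · by_cases hi : i ∈ M.verts
    · exact hf3 _ _ (hf1 i hi).symm
    · rw [hf2 i hi, hf2 i hi]
  · exact hadj _ _ (hf1 i hi) h.symm
  · rintro ⟨hij, rfl⟩
    by_cases hi : i ∈ M.verts
    · exact hf1 i hi
    · exact absurd (hf2 i hi).symm hij

theorem exists_matchingCost_eq {lam : ℝ} (h0 : 0 ≤ lam) (Y : Fin n → Leaf b δ) :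
    ∃ f : Fin n → Fin n, Function.Involutive f ∧ (∀ i j, f i = i → f j = j → i = j) ∧
      (∑ i, leafDist lam (Y i) (Y (f i))) / 2 ≤ matchingCost lam Y := by
  classical
  obtain ⟨f₀, hf₀, hfix₀⟩ := exists_involutive_subsingleton_fixed Y
  set A : Set ℝ := {c : ℝ | ∃ M : (⊤ : SimpleGraph (Fin n)).Subgraph, IsFullMatching M ∧
    c = ∑ e : Sym2 (Fin n) with e ∈ M.edgeSet, pairWeight lam Y e} with hA
  have hAfin : A.Finite := by
    refine (Set.finite_range fun M : (⊤ : SimpleGraph (Fin n)).Subgraph =>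
      ∑ e : Sym2 (Fin n) with e ∈ M.edgeSet, pairWeight lam Y e).subset ?_
    rintro _ ⟨M, -, rfl⟩
    exact ⟨M, rfl⟩
  have hAne : A.Nonempty :=
    ⟨_, matchingOf f₀ hf₀, isFullMatching_matchingOf hf₀ hfix₀, rfl⟩
  obtain ⟨M, hM, hMA⟩ := hAne.csInf_mem hAfin
  obtain ⟨f, hf, hfv, hfM⟩ := exists_involution_of_isMatching hM.1
  refine ⟨f, hf, fun i j hi hj => ?_, ?_⟩
  · rw [hfv] at hi hj
    rcases Nat.even_or_odd n with he | ho
    · rw [hM.2.1 he] at hi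
      exact absurd (Set.mem_univ i) hi
    · obtain ⟨v, hv⟩ := hM.2.2 ho
      rw [hv, Set.mem_compl_iff, not_not, Set.mem_singleton_iff] at hi hj
      rw [hi, hj]
  · rw [← sum_edges_eq_sum_involution h0 Y M hf hfM]
    refine le_of_eq (Eq.trans ?_ (hMA.symm.trans ?_))
    · congr!
    · unfold matchingCost
      congr!

/-- The optimal matching of `Y` is kept on pairs of unchanged points; the changed points and their
former partners are matched anew. -/
theorem isSmooth_matchingCost (hb : 2 ≤ b) {lam : ℝ} (h0 : 0 < lam) (h1 : lam < 1) :
    IsSmooth lam 2 (matchingCost lam : (Fin n → Leaf b δ) → ℝ) := by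
  intro X Y k hk hH
  obtain ⟨g, hg, hgfix, hgY⟩ := exists_matchingCost_eq h0.le Y
  set S : Finset (Fin n) := Finset.univ.filter fun i => X i ≠ Y i with hS
  have hSk : S.card ≤ k := hH
  -- Being closed under `g`, `U` can be rematched without touching the remaining pairs.
  set U : Finset (Fin n) := S ∪ S.image g with hU
  have hUk : U.card ≤ 2 * k := by
    have h2 := Finset.card_union_le S (S.image g)
    have h3 := Finset.card_image_le (s := S) (f := g)
    refine h2.trans ?_
    omega
  have hgU : ∀ i, i ∉ U → g i ∉ U := by
    intro i hi h
    rcases Finset.mem_union.1 h with h | h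
    · exact hi (Finset.mem_union_right _ (Finset.mem_image.2 ⟨_, h, hg i⟩))
    · obtain ⟨j, hj, hji⟩ := Finset.mem_image.1 h
      exact hi (Finset.mem_union_left _ (hg.injective hji ▸ hj))
  have hXY : ∀ i, i ∉ U → X i = Y i := by
    intro i hi
    by_contra h
    exact hi (Finset.mem_union_left _ (by simpa [hS] using h))
  obtain ⟨f, hf, hfU, hffix, hfs⟩ := exists_matching X U
  have hfmem : ∀ i, i ∈ U → f i ∈ U := by
    intro i hi
    by_contra h
    have h2 := hfU _ h
    rw [hf] at h2
    exact h (h2 ▸ hi)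
  set F : Fin n → Fin n := fun i => if i ∈ U then f i else g i with hF
  have hF1 : ∀ i, i ∈ U → F i = f i := fun i hi => by simp [hF, hi]
  have hF2 : ∀ i, i ∉ U → F i = g i := fun i hi => by simp [hF, hi]
  have hFinv : Function.Involutive F := by
    intro i
    by_cases hi : i ∈ U
    · rw [hF1 i hi, hF1 _ (hfmem i hi), hf]
    · rw [hF2 i hi, hF2 _ (hgU i hi), hg]
  -- There is at most one fixed point inside `U` and at most one outside. If there were two, `n`
  -- would be even, whereas the outer one is the only fixed point of `g` and makes `n` odd.
  have hFfix : ∀ i j, F i = i → F j = j → i = j := by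
    have hm1 := card_modEq_card_fixed hg
    have hm2 := card_modEq_card_fixed hFinv
    unfold Nat.ModEq at hm1 hm2
    set a := Finset.univ.filter fun i => g i = i with ha
    set c := Finset.univ.filter fun i => F i = i with hc
    have hca : (c.filter fun i => i ∉ U) ⊆ a := by
      intro i hi
      simp only [hc, ha, Finset.mem_filter, Finset.mem_univ, true_and] at hi ⊢
      rw [← hF2 i hi.2]
      exact hi.1
    have hc1 : (c.filter fun i => i ∈ U).card ≤ 1 := by
      refine Finset.card_le_one.2 fun i hi j hj => ?_
      simp only [hc, Finset.mem_filter, Finset.mem_univ, true_and] at hi hj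
      refine hffix i hi.2 j hj.2 ?_ ?_
      · rw [← hF1 i hi.2]
        exact hi.1
      · rw [← hF1 j hj.2]
        exact hj.1
    have ha1 : a.card ≤ 1 := by
      refine Finset.card_le_one.2 fun i hi j hj => ?_
      simp only [ha, Finset.mem_filter, Finset.mem_univ, true_and] at hi hj
      exact hgfix i j hi hj
    have hca' := Finset.card_le_card hca
    have hsum := Finset.card_filter_add_card_filter_not (s := c) (fun i => i ∈ U)
    have hcc : c.card ≤ 1 := by omega
    intro i j hi hj
    exact Finset.card_le_one.1 hcc i (by simpa [hc] using hi) j (by simpa [hc] using hj)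
  refine (matchingCost_le h0.le X hFinv hFfix).trans ?_
  have hsplit : ∑ i, leafDist lam (X i) (X (F i)) =
      ∑ i ∈ U, leafDist lam (X i) (X (f i)) + ∑ i ∈ Uᶜ, leafDist lam (Y i) (Y (g i)) := by
    rw [← Finset.sum_add_sum_compl U]
    congr 1
    · exact Finset.sum_congr rfl fun i hi => by rw [hF1 i hi]
    · refine Finset.sum_congr rfl fun i hi => ?_
      have hi' := Finset.mem_compl.1 hi
      rw [hF2 i hi', hXY i hi', hXY _ (hgU i hi')]
  have hrest : ∑ i ∈ Uᶜ, leafDist lam (Y i) (Y (g i)) ≤ ∑ i, leafDist lam (Y i) (Y (g i)) :=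
    Finset.sum_le_sum_of_subset_of_nonneg (Finset.subset_univ _)
      fun i _ _ => leafDist_nonneg h0.le _ _
  have hnew : ∑ i ∈ U, leafDist lam (X i) (X (f i)) ≤
      2 * ∑ ℓ ∈ Finset.Icc 1 δ, lam ^ ℓ * (numClasses X ℓ U : ℝ) := by
    simp only [leafDist_eq_sum_split h0.le]
    rw [Finset.sum_comm, Finset.mul_sum]
    refine Finset.sum_le_sum fun ℓ hℓ => ?_
    rw [← Finset.mul_sum, mul_assoc]
    have h2 : (∑ i ∈ U, (split X ℓ i (f i) : ℝ)) ≤ numClasses X ℓ U := by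
      exact_mod_cast hfs ℓ (Finset.mem_Icc.1 hℓ).2
    gcongr
  have hlev := sum_levels_le (δ := δ) h0 h1 hb hk (N := fun ℓ => (numClasses X ℓ U : ℝ))
    (fun ℓ => by exact_mod_cast numClasses_le_pow (by omega) X ℓ U)
    (fun ℓ => by exact_mod_cast (numClasses_le_card X ℓ U).trans hUk)
  linarith

/-! ### Concentration of functions of independent uniform points -/

section Concentration

open scoped BigOperators

/-- A linear majorant of the concave power, used with `s = √n` to bound a mean of `α`-th powers by
the mean itself. -/
theorem rpow_le_mul_one_add {s α : ℝ} (hs : 0 < s) (hα : 0 < α) (hα1 : α ≤ 1) {x : ℝ}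
    (hx : 0 ≤ x) : x ^ α ≤ s ^ α * (1 + x / s) := by
  have hsα : 0 < s ^ α := Real.rpow_pos_of_pos hs α
  rcases le_total x s with h | h
  · have h1 : x ^ α ≤ s ^ α := Real.rpow_le_rpow hx h hα.le
    have h2 : 0 ≤ x / s := by positivity
    nlinarith
  · have h1 : 1 ≤ x / s := (one_le_div hs).2 h
    have h2 : x ^ α = s ^ α * (x / s) ^ α := by
      rw [← Real.mul_rpow hs.le (by positivity)]
      congr 1
      field_simp
    have h3 : (x / s) ^ α ≤ x / s := by
      simpa using Real.rpow_le_rpow_of_exponent_le h1 hα1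
    rw [h2]
    refine mul_le_mul_of_nonneg_left ?_ hsα.le
    linarith

variable {Ω : Type*}

theorem hammingDist_cons [DecidableEq Ω] {n : ℕ} (a a' : Ω) (y y' : Fin n → Ω) :
    hammingDist (Fin.cons a y : Fin (n + 1) → Ω) (Fin.cons a' y') =
      (if a ≠ a' then 1 else 0) + hammingDist y y' := by
  simp only [hammingDist, Finset.card_filter, Fin.sum_univ_succ, Fin.cons_zero, Fin.cons_succ]

/-- The Hamming distance from a set of points. -/
def distTo [DecidableEq Ω] {n : ℕ} (A : Finset (Fin n → Ω)) (hA : A.Nonempty) (x : Fin n → Ω) : ℕ :=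
  A.inf' hA (hammingDist x)

theorem distTo_lipschitz [DecidableEq Ω] {n : ℕ} (A : Finset (Fin n → Ω)) (hA : A.Nonempty) (x y : Fin n → Ω) :
    |(distTo A hA x : ℝ) - distTo A hA y| ≤ hammingDist x y := by
  have key : ∀ x y, distTo A hA x ≤ distTo A hA y + hammingDist x y := by
    intro x y
    obtain ⟨z, hz, hzy⟩ := Finset.exists_mem_eq_inf' hA (hammingDist y)
    refine (Finset.inf'_le (hammingDist x) hz).trans ?_
    rw [distTo, hzy, add_comm]
    exact hammingDist_triangle x y z
  have h1 : (distTo A hA x : ℝ) ≤ distTo A hA y + hammingDist x y := by exact_mod_cast key x y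
  have h2 : (distTo A hA y : ℝ) ≤ distTo A hA x + hammingDist x y := by
    rw [hammingDist_comm x y]
    exact_mod_cast key y x
  rw [abs_le]
  constructor <;> linarith

variable [Fintype Ω]

theorem expect_fin_succ {n : ℕ} (F : (Fin (n + 1) → Ω) → ℝ) :
    𝔼 x, F x = 𝔼 a, 𝔼 y, F (Fin.cons a y) := by
  rw [← Finset.expect_product' Finset.univ Finset.univ fun (a : Ω) (y : Fin n → Ω) =>
    F (Fin.cons a y), Finset.univ_product_univ]
  exact (Fintype.expect_equiv (Fin.consEquiv fun _ => Ω) _ _ fun _ => rfl).symm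

/-- A function with Hölder continuity for the Hamming distance is bounded in terms of the
distance from a sublevel set. -/
theorem le_add_distTo [DecidableEq Ω] {n : ℕ} {L : (Fin n → Ω) → ℝ} {C α : ℝ}
    (hL : ∀ x y, L x ≤ L y + C * (hammingDist x y : ℝ) ^ α) {m : ℝ}
    (hA : (Finset.univ.filter fun x => L x ≤ m).Nonempty) (x : Fin n → Ω) :
    L x ≤ m + C * (distTo _ hA x : ℝ) ^ α := by
  obtain ⟨z, hz, hzx⟩ := Finset.exists_mem_eq_inf' hA (hammingDist x)
  have h1 := hL x z
  have h2 := (Finset.mem_filter.1 hz).2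
  rw [distTo, hzx]
  linarith

variable [Nonempty Ω]

/-- Jensen's inequality, from the tangent line of the exponential at the mean. -/
theorem exp_expect_le (h : Ω → ℝ) : Real.exp (𝔼 a, h a) ≤ 𝔼 a, Real.exp (h a) := by
  set m := 𝔼 a, h a with hm
  have h1 : 𝔼 a, Real.exp m * (1 + (h a - m)) ≤ 𝔼 a, Real.exp (h a) := by
    refine Finset.expect_le_expect fun a _ => ?_
    have h2 : Real.exp (h a) = Real.exp m * Real.exp (h a - m) := by
      rw [← Real.exp_add]
      ring_nf
    rw [h2]
    refine mul_le_mul_of_nonneg_left ?_ (Real.exp_pos _).le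
    linarith [Real.add_one_le_exp (h a - m)]
  rw [← Finset.mul_expect, Finset.expect_add_distrib, Finset.expect_sub_distrib,
    Fintype.expect_const, Fintype.expect_const, ← hm, sub_self, add_zero, mul_one] at h1
  exact h1

/-- The moment generating function of a function whose values differ by at most `1`. -/
theorem expect_exp_le_of_abs_sub_le_one (g : Ω → ℝ) (hg : ∀ a a', |g a - g a'| ≤ 1) (θ : ℝ) :
    𝔼 a, Real.exp (θ * (g a - 𝔼 a', g a')) ≤ Real.exp (θ ^ 2 / 2) := by
  -- Symmetrization: by Jensen the mean is replaced by an independent copy. Exchanging the copies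
  -- then turns the exponential into a hyperbolic cosine.
  have h1 : 𝔼 a, Real.exp (θ * (g a - 𝔼 a', g a')) ≤
      𝔼 a, 𝔼 a', Real.exp (θ * (g a - g a')) := by
    refine Finset.expect_le_expect fun a _ => ?_
    refine le_trans (le_of_eq ?_) (exp_expect_le fun a' => θ * (g a - g a'))
    rw [← Finset.mul_expect, Finset.expect_sub_distrib, Fintype.expect_const]
  have h2 : 𝔼 a, 𝔼 a', Real.exp (θ * (g a - g a')) =
      𝔼 a, 𝔼 a', Real.exp (-(θ * (g a - g a'))) := by
    rw [Finset.expect_comm]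
    refine Finset.expect_congr rfl fun a _ => Finset.expect_congr rfl fun a' _ => ?_
    ring_nf
  have h3 : 𝔼 a, 𝔼 a', Real.exp (θ * (g a - g a')) + 𝔼 a, 𝔼 a', Real.exp (-(θ * (g a - g a'))) ≤
      2 * Real.exp (θ ^ 2 / 2) := by
    rw [← Finset.expect_add_distrib]
    refine Finset.expect_le Finset.univ_nonempty fun a _ => ?_
    rw [← Finset.expect_add_distrib]
    refine Finset.expect_le Finset.univ_nonempty fun a' _ => ?_
    have h4 := Real.cosh_le_exp_half_sq (θ * (g a - g a'))
    rw [Real.cosh_eq] at h4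
    have h5 : (θ * (g a - g a')) ^ 2 ≤ θ ^ 2 := by
      rw [mul_pow]
      refine mul_le_of_le_one_right (sq_nonneg θ) ?_
      rw [sq_le_one_iff_abs_le_one]
      exact hg a a'
    have h6 : Real.exp ((θ * (g a - g a')) ^ 2 / 2) ≤ Real.exp (θ ^ 2 / 2) := by
      gcongr
    linarith
  linarith

/-- The median is the least value of `L` whose sublevel set has at least half of the points. -/
theorem exists_median (L : Ω → ℝ) :
    ∃ m, Fintype.card Ω ≤ 2 * (Finset.univ.filter fun x => L x ≤ m).card ∧
      Fintype.card Ω ≤ 2 * (Finset.univ.filter fun x => m ≤ L x).card := by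
  classical
  set V := (Finset.univ.image L).filter fun v =>
    Fintype.card Ω ≤ 2 * (Finset.univ.filter fun x => L x ≤ v).card with hV
  have hVne : V.Nonempty := by
    obtain ⟨x, -, hx⟩ := Finset.exists_max_image Finset.univ L Finset.univ_nonempty
    refine ⟨L x, Finset.mem_filter.2 ⟨Finset.mem_image_of_mem L (Finset.mem_univ x), ?_⟩⟩
    rw [Finset.filter_true_of_mem hx, Finset.card_univ]
    omega
  obtain ⟨m, hm, hmin⟩ := Finset.exists_min_image V id hVne
  refine ⟨m, (Finset.mem_filter.1 hm).2, ?_⟩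
  by_contra hcon
  have h1 := Finset.card_filter_add_card_filter_not (s := (Finset.univ : Finset Ω))
    (fun x => m ≤ L x)
  rw [Finset.card_univ] at h1
  simp only [not_le] at h1
  have h2 : (Finset.univ.filter fun x => L x < m).Nonempty := by
    rw [← Finset.card_pos]
    omega
  obtain ⟨y, hy, hymax⟩ := Finset.exists_max_image _ L h2
  have hy' := (Finset.mem_filter.1 hy).2
  have h3 : L y ∈ V := by
    refine Finset.mem_filter.2 ⟨Finset.mem_image_of_mem L (Finset.mem_univ y), ?_⟩
    have h4 : (Finset.univ.filter fun x => L x < m) ⊆ Finset.univ.filter fun x => L x ≤ L y :=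
      fun x hx => Finset.mem_filter.2 ⟨Finset.mem_univ x, hymax x hx⟩
    have := Finset.card_le_card h4
    omega
  exact absurd (hmin _ h3) (not_le.2 hy')

variable [DecidableEq Ω]

/-- The moment generating function of a function that is `1`-Lipschitz for the Hamming
distance. -/
theorem expect_exp_le_of_lipschitz (n : ℕ) (f : (Fin n → Ω) → ℝ)
    (hf : ∀ x y, |f x - f y| ≤ hammingDist x y) (θ : ℝ) :
    𝔼 x, Real.exp (θ * (f x - 𝔼 y, f y)) ≤ Real.exp (n * (θ ^ 2 / 2)) := by
  induction n with
  | zero =>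
    simp
  | succ n ih =>
    -- The deviation splits into that of `f` from `g a` with the first coordinate fixed, covered by
    -- induction, and that of `g`, a function of one coordinate that varies by at most 1.
    set g : Ω → ℝ := fun a => 𝔼 y, f (Fin.cons a y) with hg
    have hg1 : ∀ a a', |g a - g a'| ≤ 1 := by
      intro a a'
      simp only [hg]
      rw [← Finset.expect_sub_distrib]
      refine (Finset.abs_expect_le _ _).trans ?_
      refine Finset.expect_le Finset.univ_nonempty fun y _ => ?_
      refine (hf _ _).trans ?_
      rw [hammingDist_cons, hammingDist_self]
      split_ifs <;> simp
    have hmean : 𝔼 x, f x = 𝔼 a, g a := expect_fin_succ f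
    rw [hmean, expect_fin_succ]
    have h1 : ∀ a, 𝔼 y, Real.exp (θ * (f (Fin.cons a y) - 𝔼 a', g a')) ≤
        Real.exp (θ * (g a - 𝔼 a', g a')) * Real.exp (n * (θ ^ 2 / 2)) := by
      intro a
      have h2 := ih (fun y => f (Fin.cons a y)) fun y y' => by
        simpa [hammingDist_cons] using hf (Fin.cons a y) (Fin.cons a y')
      refine le_trans (le_of_eq ?_) (mul_le_mul_of_nonneg_left h2 (Real.exp_pos _).le)
      rw [Finset.mul_expect]
      refine Finset.expect_congr rfl fun y _ => ?_
      rw [← Real.exp_add]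
      congr 1
      simp only [hg]
      ring
    refine (Finset.expect_le_expect fun a _ => h1 a).trans ?_
    rw [← Finset.expect_mul]
    refine (mul_le_mul_of_nonneg_right (expect_exp_le_of_abs_sub_le_one g hg1 θ)
      (Real.exp_pos _).le).trans (le_of_eq ?_)
    rw [← Real.exp_add]
    congr 1
    push_cast
    ring

theorem card_deviation_le {n : ℕ} (hn : 1 ≤ n) (f : (Fin n → Ω) → ℝ)
    (hf : ∀ x y, |f x - f y| ≤ hammingDist x y) {s : ℝ} (hs : 0 ≤ s) :
    ((Finset.univ.filter fun x => s ≤ f x - 𝔼 y, f y).card : ℝ) ≤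
      Fintype.card (Fin n → Ω) * Real.exp (-(s ^ 2 / (2 * n))) := by
  have hn0 : (0 : ℝ) < n := by exact_mod_cast hn
  -- This `θ` minimizes the Chernoff exponent `n * θ ^ 2 / 2 - θ * s`.
  set θ := s / n with hθ
  have h1 := expect_exp_le_of_lipschitz n f hf θ
  rw [Fintype.expect_eq_sum_div_card, div_le_iff₀ (by exact_mod_cast Fintype.card_pos)] at h1
  have h2 : ((Finset.univ.filter fun x => s ≤ f x - 𝔼 y, f y).card : ℝ) * Real.exp (θ * s) ≤
      ∑ x, Real.exp (θ * (f x - 𝔼 y, f y)) := by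
    rw [← nsmul_eq_mul]
    refine (Finset.card_nsmul_le_sum _ (fun x => Real.exp (θ * (f x - 𝔼 y, f y))) _
      fun x hx => ?_).trans (Finset.sum_le_sum_of_subset_of_nonneg (Finset.subset_univ _)
        fun x _ _ => (Real.exp_pos _).le)
    have h3 := (Finset.mem_filter.1 hx).2
    have h4 : 0 ≤ θ := by positivity
    gcongr
  have h5 : Real.exp (n * (θ ^ 2 / 2)) = Real.exp (-(s ^ 2 / (2 * n))) * Real.exp (θ * s) := by
    rw [← Real.exp_add]
    congr 1
    rw [hθ]
    field_simp
    ring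
  rw [h5] at h1
  refine le_of_mul_le_mul_right (h2.trans (h1.trans (le_of_eq ?_))) (Real.exp_pos (θ * s))
  ring

/-- The mean distance from a set that has at least half of the points. -/
theorem expect_distTo_le {n : ℕ} (hn : 1 ≤ n) (A : Finset (Fin n → Ω)) (hA : A.Nonempty)
    (hA2 : Fintype.card (Fin n → Ω) ≤ 2 * A.card) :
    𝔼 x, (distTo A hA x : ℝ) ≤ 2 * √n := by
  have hn0 : (0 : ℝ) < n := by exact_mod_cast hn
  set m := 𝔼 x, (distTo A hA x : ℝ) with hm
  have hm0 : 0 ≤ m := Finset.expect_nonneg fun x _ => Nat.cast_nonneg _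
  -- On `A` the distance vanishes and so lies `m` below its mean. As `A` has at least half of the
  -- points, `1/2 ≤ exp (-(m ^ 2 / (2 * n)))`, which forces `m ^ 2 ≤ 2 * n`.
  have h1 := card_deviation_le hn (fun x => -(distTo A hA x : ℝ)) (fun x y => by
    rw [neg_sub_neg, abs_sub_comm]
    exact distTo_lipschitz A hA x y) hm0
  rw [Finset.expect_neg_distrib, ← hm] at h1
  have h2 : A ⊆ Finset.univ.filter fun x => m ≤ -(distTo A hA x : ℝ) - -m := by
    intro x hx
    have h3 : distTo A hA x = 0 := by
      refine Nat.le_zero.1 ((Finset.inf'_le (hammingDist x) hx).trans ?_)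
      rw [hammingDist_self]
    simp [h3]
  have h4 : (A.card : ℝ) ≤ _ := (Nat.cast_le.2 (Finset.card_le_card h2)).trans h1
  have hN : (0 : ℝ) < Fintype.card (Fin n → Ω) := by exact_mod_cast Fintype.card_pos
  have h5 : (Fintype.card (Fin n → Ω) : ℝ) ≤ 2 * A.card := by exact_mod_cast hA2
  have h6 : 1 ≤ 2 * Real.exp (-(m ^ 2 / (2 * n))) := by
    refine le_of_mul_le_mul_left ?_ hN
    linarith
  have h7 : m ^ 2 / (2 * n) ≤ 1 := by
    by_contra h
    push Not at h
    have h8 : Real.exp (-(m ^ 2 / (2 * n))) < Real.exp (-1) := Real.exp_lt_exp.2 (by linarith)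
    have h9 := Real.exp_neg_one_lt_half
    linarith
  rw [div_le_one (by positivity)] at h7
  refine (sq_le_sq₀ hm0 (by positivity)).1 ?_
  rw [mul_pow, Real.sq_sqrt hn0.le]
  linarith

/-- The mean distance is at most `2 * √n ≤ r / 2`, so a distance of `r` is a deviation of at least
`r / 2`. -/
theorem card_le_distTo_le {n : ℕ} (hn : 1 ≤ n) (A : Finset (Fin n → Ω)) (hA : A.Nonempty)
    (hA2 : Fintype.card (Fin n → Ω) ≤ 2 * A.card) {r : ℝ} (hr : 4 * √n ≤ r) :
    ((Finset.univ.filter fun x => r ≤ (distTo A hA x : ℝ)).card : ℝ) ≤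
      Fintype.card (Fin n → Ω) * Real.exp (-(r ^ 2 / (8 * n))) := by
  have h1 := expect_distTo_le hn A hA hA2
  have hr0 : 0 ≤ r := le_trans (by positivity) hr
  have h2 := card_deviation_le hn (fun x => (distTo A hA x : ℝ)) (distTo_lipschitz A hA)
    (s := r / 2) (by positivity)
  have h3 : (r / 2) ^ 2 / (2 * (n : ℝ)) = r ^ 2 / (8 * n) := by
    rw [div_pow, div_div]
    ring_nf
  rw [h3] at h2
  refine le_trans ?_ h2
  refine Nat.cast_le.2 (Finset.card_le_card fun x hx => ?_)
  simp only [Finset.mem_filter, Finset.mem_univ, true_and] at hx ⊢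
  linarith

theorem expect_distTo_rpow_le {n : ℕ} (hn : 1 ≤ n) (A : Finset (Fin n → Ω)) (hA : A.Nonempty)
    (hA2 : Fintype.card (Fin n → Ω) ≤ 2 * A.card) {α : ℝ} (hα : 0 < α) (hα1 : α ≤ 1) :
    𝔼 x, (distTo A hA x : ℝ) ^ α ≤ 3 * √n ^ α := by
  have hs : 0 < √(n : ℝ) := Real.sqrt_pos.2 (by exact_mod_cast hn)
  have h1 : 𝔼 x, (distTo A hA x : ℝ) ^ α ≤
      𝔼 x, √n ^ α * (1 + (distTo A hA x : ℝ) / √n) :=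
    Finset.expect_le_expect fun x _ => rpow_le_mul_one_add hs hα hα1 (Nat.cast_nonneg _)
  rw [← Finset.mul_expect, Finset.expect_add_distrib, Fintype.expect_const,
    ← Finset.expect_div] at h1
  have h2 : (𝔼 x, (distTo A hA x : ℝ)) / √n ≤ 2 := by
    rw [div_le_iff₀ hs]
    exact expect_distTo_le hn A hA hA2
  have h3 : 0 < √(n : ℝ) ^ α := Real.rpow_pos_of_pos hs α
  nlinarith

/-- The upper tail of a function with Hölder continuity for the Hamming distance. -/
theorem card_upper_tail_le {n : ℕ} (hn : 1 ≤ n) {L : (Fin n → Ω) → ℝ} {C α : ℝ} (hC : 0 < C)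
    (hα : 0 < α) (hα1 : α ≤ 1)
    (hL : ∀ x y, L x ≤ L y + C * (hammingDist x y : ℝ) ^ α) {t : ℝ} (ht : 8 * C * √n ^ α ≤ t) :
    ((Finset.univ.filter fun x => t ≤ L x - 𝔼 y, L y).card : ℝ) ≤
      Fintype.card (Fin n → Ω) *
        Real.exp (-(t ^ (2 / α) / (8 * (8 * C) ^ (2 / α) * n))) := by
  have hn0 : (0 : ℝ) < n := by exact_mod_cast hn
  have hs : 0 < √(n : ℝ) := Real.sqrt_pos.2 hn0
  have hsα : 0 < √(n : ℝ) ^ α := Real.rpow_pos_of_pos hs α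
  have hN : 0 < Fintype.card (Fin n → Ω) := Fintype.card_pos
  have ht0 : 0 < t := lt_of_lt_of_le (by positivity) ht
  obtain ⟨m, hm1, hm2⟩ := exists_median L
  have hA : (Finset.univ.filter fun x => L x ≤ m).Nonempty := by
    rw [← Finset.card_pos]; omega
  have hneg : (Finset.univ.filter fun x => m ≤ L x) =
      Finset.univ.filter fun x => -L x ≤ -m := by
    simp only [neg_le_neg_iff]
  rw [hneg] at hm2
  have hB : (Finset.univ.filter fun x => -L x ≤ -m).Nonempty := by
    rw [← Finset.card_pos]; omega
  have hup := le_add_distTo hL hA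
  have hlow := le_add_distTo (L := fun x => -L x) (C := C) (α := α) (fun x y => by
    have := hL y x
    rw [hammingDist_comm] at this
    linarith) hB
  -- The mean cannot lie far below the median: this uses the distance to the superlevel set `{m ≤
  -- L}`.
  have hmean : m - 𝔼 y, L y ≤ 3 * C * √n ^ α := by
    have h1 : 𝔼 y, -L y ≤ 𝔼 y, (-m + C * (distTo _ hB y : ℝ) ^ α) :=
      Finset.expect_le_expect fun y _ => hlow y
    rw [Finset.expect_neg_distrib, Finset.expect_add_distrib, Fintype.expect_const,
      ← Finset.mul_expect] at h1
    have h2 := mul_le_mul_of_nonneg_left (expect_distTo_rpow_le hn _ hB hm2 hα hα1) hC.le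
    linarith
  -- Since `3 * C * √n ^ α ≤ t / 2`, exceeding the mean by `t` means exceeding the median by `t /
  -- 2`, hence a distance of at least `r` from the sublevel set.
  set r := (t / (2 * C)) ^ (1 / α) with hr
  have hr4 : 4 * √n ≤ r := by
    have h1 : (4 * √(n : ℝ)) ^ α ≤ t / (2 * C) := by
      rw [Real.mul_rpow (by norm_num) hs.le, le_div_iff₀ (by positivity)]
      have h2 : (4 : ℝ) ^ α ≤ 4 := by
        simpa using Real.rpow_le_rpow_of_exponent_le (x := 4) (by norm_num) hα1
      have h3 := mul_le_mul_of_nonneg_right h2 (mul_pos hsα (mul_pos two_pos hC)).le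
      linarith
    have h2 := Real.rpow_le_rpow (by positivity) h1 (z := 1 / α) (by positivity)
    rwa [← Real.rpow_mul (by positivity), mul_one_div_cancel hα.ne', Real.rpow_one] at h2
  have hsub : (Finset.univ.filter fun x => t ≤ L x - 𝔼 y, L y) ⊆
      Finset.univ.filter fun x => r ≤ (distTo _ hA x : ℝ) := by
    intro x hx
    simp only [Finset.mem_filter, Finset.mem_univ, true_and] at hx ⊢
    have h1 := hup x
    have h2 : t / (2 * C) ≤ (distTo _ hA x : ℝ) ^ α := by
      rw [div_le_iff₀ (by positivity)]
      linarith
    have h3 := Real.rpow_le_rpow (by positivity) h2 (z := 1 / α) (by positivity)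
    rwa [← Real.rpow_mul (Nat.cast_nonneg _), mul_one_div_cancel hα.ne', Real.rpow_one] at h3
  refine (Nat.cast_le.2 (Finset.card_le_card hsub)).trans
    ((card_le_distTo_le hn _ hA hm1 hr4).trans ?_)
  refine mul_le_mul_of_nonneg_left (Real.exp_le_exp.2 (neg_le_neg ?_)) (Nat.cast_nonneg _)
  have hr2 : r ^ 2 = t ^ (2 / α) / (2 * C) ^ (2 / α) := by
    rw [hr, ← Real.rpow_natCast, ← Real.rpow_mul (by positivity),
      ← Real.div_rpow ht0.le (by positivity)]
    congr 1
    push_cast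
    ring
  rw [hr2, div_div]
  -- The larger constant `8 * C` matches the threshold for `t`, so that the same bound is trivial
  -- below it.
  have h1 : (2 * C) ^ (2 / α) ≤ (8 * C) ^ (2 / α) :=
    Real.rpow_le_rpow (by positivity) (by linarith) (by positivity)
  have h2 : 0 < (2 * C) ^ (2 / α) := Real.rpow_pos_of_pos (by positivity) _
  refine div_le_div_of_nonneg_left (Real.rpow_nonneg ht0.le _) (by positivity) ?_
  nlinarith

/-- Concentration of a function with Hölder continuity for the Hamming distance. -/
theorem card_abs_deviation_le {n : ℕ} (hn : 1 ≤ n) {L : (Fin n → Ω) → ℝ} {C α : ℝ} (hC : 0 < C)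
    (hα : 0 < α) (hα1 : α ≤ 1)
    (hL : ∀ x y, L x ≤ L y + C * (hammingDist x y : ℝ) ^ α) {t : ℝ} (ht0 : 0 ≤ t) :
    ((Finset.univ.filter fun x => t ≤ |L x - 𝔼 y, L y|).card : ℝ) ≤
      Fintype.card (Fin n → Ω) *
        (8 * Real.exp (-(t ^ (2 / α) / (8 * (8 * C) ^ (2 / α) * n)))) := by
  have hn0 : (0 : ℝ) < n := by exact_mod_cast hn
  have hs : 0 < √(n : ℝ) := Real.sqrt_pos.2 hn0
  have hN : (0 : ℝ) < Fintype.card (Fin n → Ω) := by exact_mod_cast Fintype.card_pos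
  by_cases ht : 8 * C * √n ^ α ≤ t
  · have h1 := card_upper_tail_le hn hC hα hα1 hL ht
    have h2 := card_upper_tail_le (L := fun x => -L x) hn hC hα hα1 (fun x y => by
      have := hL y x
      rw [hammingDist_comm] at this
      linarith) ht
    have hsub : (Finset.univ.filter fun x => t ≤ |L x - 𝔼 y, L y|) ⊆
        (Finset.univ.filter fun x => t ≤ L x - 𝔼 y, L y) ∪
          Finset.univ.filter fun x => t ≤ -L x - 𝔼 y, -L y := by
      intro x hx
      simp only [Finset.mem_filter, Finset.mem_univ, true_and, Finset.mem_union] at hx ⊢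
      rcases le_abs.1 hx with h | h
      · exact Or.inl h
      · right
        rw [Finset.expect_neg_distrib]
        linarith
    have h3 : ((Finset.univ.filter fun x => t ≤ |L x - 𝔼 y, L y|).card : ℝ) ≤
        (Finset.univ.filter fun x => t ≤ L x - 𝔼 y, L y).card +
          (Finset.univ.filter fun x => t ≤ -L x - 𝔼 y, -L y).card := by
      exact_mod_cast (Finset.card_le_card hsub).trans (Finset.card_union_le _ _)
    have h4 := mul_pos hN (Real.exp_pos (-(t ^ (2 / α) / (8 * (8 * C) ^ (2 / α) * n))))
    linarith
  · push Not at ht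
    -- Below the threshold the exponent is at least `-1/8`, and `8 * exp (-1/8) ≥ 7`.
    have h1 : t ^ (2 / α) ≤ (8 * C) ^ (2 / α) * n := by
      refine (Real.rpow_le_rpow ht0 ht.le (z := 2 / α) (by positivity)).trans (le_of_eq ?_)
      rw [Real.mul_rpow (by positivity) (by positivity), ← Real.rpow_mul hs.le,
        mul_div_cancel₀ _ hα.ne', Real.rpow_two, Real.sq_sqrt hn0.le]
    have h2 : t ^ (2 / α) / (8 * (8 * C) ^ (2 / α) * n) ≤ 1 / 8 := by
      have h3 : 0 < (8 * C) ^ (2 / α) := Real.rpow_pos_of_pos (by positivity) _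
      rw [div_le_iff₀ (by positivity)]
      linarith
    have h3 := Real.add_one_le_exp (-(t ^ (2 / α) / (8 * (8 * C) ^ (2 / α) * n)))
    have h4 : ((Finset.univ.filter fun x => t ≤ |L x - 𝔼 y, L y|).card : ℝ) ≤
        Fintype.card (Fin n → Ω) := by
      exact_mod_cast Finset.card_le_univ _
    nlinarith

end Concentration

/-! ### Concentration of smooth functionals -/

section Smooth

open scoped BigOperators

/-- This reduces probabilities to cardinalities and the integral to the finite average `𝔼`. -/
theorem leafMeasure_eq : leafMeasure b δ n = uniformOn Set.univ := by
  have h := uniformOn_pi (ι := Fin n) (Ω := Leaf b δ) (f := fun _ => Set.univ)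
  rw [Set.pi_univ] at h
  exact h.symm

theorem leafMeasure_real_eq (s : Finset (Fin n → Leaf b δ)) :
    (leafMeasure b δ n).real (s : Set (Fin n → Leaf b δ)) =
      s.card / Fintype.card (Fin n → Leaf b δ) := by
  rw [leafMeasure_eq, measureReal_def, uniformOn_univ, Measure.count_apply_finset,
    ENNReal.toReal_div, ENNReal.toReal_natCast, ENNReal.toReal_natCast]

theorem integral_leafMeasure_eq (hb : 1 ≤ b) (L : (Fin n → Leaf b δ) → ℝ) :
    ∫ Y, L Y ∂(leafMeasure b δ n) = 𝔼 Y, L Y := by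
  have : NeZero b := ⟨by omega⟩
  have : IsProbabilityMeasure (leafMeasure b δ n) := by
    rw [leafMeasure_eq]
    exact isProbabilityMeasure_uniformOn Set.finite_univ Set.univ_nonempty
  rw [integral_fintype (Integrable.of_finite), Fintype.expect_eq_sum_div_card, Finset.sum_div]
  refine Finset.sum_congr rfl fun Y _ => ?_
  have h := leafMeasure_real_eq ({Y} : Finset (Fin n → Leaf b δ))
  rw [Finset.coe_singleton, Finset.card_singleton] at h
  rw [h, smul_eq_mul]
  push_cast
  ring

open Classical in
theorem deviationProb_eq (hb : 1 ≤ b) (L : (Fin n → Leaf b δ) → ℝ) (t : ℝ) :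
    deviationProb L t = (Finset.univ.filter fun X => t ≤ |L X - 𝔼 Y, L Y|).card /
      Fintype.card (Fin n → Leaf b δ) := by
  rw [deviationProb, integral_leafMeasure_eq hb, ← leafMeasure_real_eq]
  simp

theorem IsSmooth.mono {lam K K' : ℝ} (h0 : 0 ≤ lam) (h1 : lam < 1) (hK : K ≤ K')
    {L : (Fin n → Leaf b δ) → ℝ} (hL : IsSmooth lam K L) : IsSmooth lam K' L := by
  intro X Y k hk hH
  refine (hL X Y k hk hH).trans (add_le_add le_rfl ?_)
  exact div_le_div_of_nonneg_right (mul_le_mul_of_nonneg_right hK (Top_nonneg h0 k))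
    (sub_pos.2 h1).le

theorem Top_half_eq (k : ℕ) :
    Top b δ (1 / 2) k = ∑ i ∈ Finset.Icc 1 (min δ (Nat.clog b k)), ((b : ℝ) / 2) ^ i := by
  refine Finset.sum_congr rfl fun i _ => ?_
  rw [← mul_pow]
  congr 1
  ring

/-- A geometric sum with ratio `q = b / 2 ≥ 3/2` is at most three times its last term `q ^ c`. With
`e = c - 1` one has `b ^ e < k`, whence `q ^ e ≤ k ^ α`; the lost factor `q` gives the `b` in the
constant. -/
theorem Top_half_le (hb : 3 ≤ b) {k : ℕ} (hk : 2 ≤ k) :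
    Top b δ (1 / 2) k ≤ 3 / 2 * b * (k : ℝ) ^ Real.logb b (b / 2) := by
  have hb3 : (3 : ℝ) ≤ b := by exact_mod_cast hb
  set q : ℝ := (b : ℝ) / 2 with hq
  have hq0 : 0 < q := by positivity
  have hgeo : ∀ m : ℕ, ∑ i ∈ Finset.Icc 1 m, q ^ i ≤ 3 * q ^ m := by
    intro m
    induction m with
    | zero => simp
    | succ m ih =>
      rw [Finset.sum_Icc_succ_top (by omega), pow_succ]
      have : 0 < q ^ m := by positivity
      nlinarith
  set c := Nat.clog b k with hc
  have hc1 : 1 ≤ c := Nat.clog_pos (by omega) hk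
  obtain ⟨e, he⟩ : ∃ e, c = e + 1 := ⟨c - 1, by omega⟩
  have hek : b ^ e ≤ k := by
    have := Nat.pow_pred_clog_lt_self (b := b) (by omega) hk
    rw [← hc, he] at this
    exact this.le
  have hqb : q = (b : ℝ) ^ Real.logb b q :=
    (Real.rpow_logb (by positivity) (by linarith) hq0).symm
  have hα : 0 ≤ Real.logb b q := Real.logb_nonneg (by linarith) (by linarith)
  have hqe : q ^ e ≤ (k : ℝ) ^ Real.logb b q := by
    calc q ^ e = ((b : ℝ) ^ Real.logb b q) ^ e := by rw [← hqb]
      _ = ((b : ℝ) ^ e) ^ Real.logb b q := by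
        rw [← Real.rpow_natCast, ← Real.rpow_natCast, ← Real.rpow_mul (by positivity),
          ← Real.rpow_mul (by positivity), mul_comm]
      _ ≤ (k : ℝ) ^ Real.logb b q :=
        Real.rpow_le_rpow (by positivity) (by exact_mod_cast hek) hα
  rw [Top_half_eq]
  calc ∑ i ∈ Finset.Icc 1 (min δ c), q ^ i ≤ ∑ i ∈ Finset.Icc 1 c, q ^ i :=
        Finset.sum_le_sum_of_subset_of_nonneg
          (Finset.Icc_subset_Icc le_rfl (min_le_right _ _)) fun _ _ _ => by positivity
    _ ≤ 3 * q ^ c := hgeo c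
    _ = 3 / 2 * b * q ^ e := by
      rw [he, pow_succ, hq]
      ring
    _ ≤ 3 / 2 * b * (k : ℝ) ^ Real.logb b q := by gcongr

theorem IsSmooth.holder (hb : 3 ≤ b) {K : ℝ} (hK : 0 < K) {L : (Fin n → Leaf b δ) → ℝ}
    (hL : IsSmooth (1 / 2) K L) (X Y : Fin n → Leaf b δ) :
    L X ≤ L Y + 6 * K * b * (hammingDist X Y : ℝ) ^ Real.logb b (b / 2) := by
  have hb3 : (3 : ℝ) ≤ b := by exact_mod_cast hb
  have hα : 0 < Real.logb b ((b : ℝ) / 2) := Real.logb_pos (by linarith) (by linarith)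
  have hα1 : Real.logb b ((b : ℝ) / 2) ≤ 1 := by
    rw [Real.logb_le_iff_le_rpow (by linarith) (by positivity), Real.rpow_one]
    linarith
  set α := Real.logb b ((b : ℝ) / 2) with hαdef
  have key : ∀ k : ℕ, 2 ≤ k → hammingDist X Y ≤ k → L X ≤ L Y + 3 * K * b * (k : ℝ) ^ α := by
    intro k hk hH
    refine (hL X Y k hk hH).trans (add_le_add le_rfl ?_)
    have h1 := mul_le_mul_of_nonneg_left (Top_half_le (δ := δ) hb hk) hK.le
    rw [div_le_iff₀ (by norm_num)]
    linarith
  -- Smoothness speaks of `k ≥ 2` only. For distance 1 it is applied with `k = 2`, and `2 ^ α ≤ 2`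
  -- doubles the constant to `6 * K * b`.
  rcases Nat.lt_or_ge (hammingDist X Y) 2 with h | h
  · rcases Nat.eq_zero_or_pos (hammingDist X Y) with h0 | h0
    · rw [hammingDist_eq_zero.1 h0]
      have : 0 ≤ 6 * K * b * (hammingDist Y Y : ℝ) ^ α := by positivity
      linarith
    · have h1 : hammingDist X Y = 1 := by omega
      have h2 := key 2 le_rfl (by omega)
      have h3 : ((2 : ℕ) : ℝ) ^ α ≤ 2 := by
        simpa using Real.rpow_le_rpow_of_exponent_le (x := 2) (by norm_num) hα1
      rw [h1, Nat.cast_one, Real.one_rpow, mul_one]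
      have h4 := mul_le_mul_of_nonneg_left h3 (by positivity : 0 ≤ 3 * K * b)
      linarith
  · have h1 := key _ h le_rfl
    have : 0 ≤ 3 * K * b * (hammingDist X Y : ℝ) ^ α := by positivity
    linarith

theorem exists_deviationProb_le (hb : 3 ≤ b) {K : ℝ} (hK : 0 < K) :
    ∃ c : ℝ, 0 < c ∧
      ∀ (δ n : ℕ) (L : (Fin n → Leaf b δ) → ℝ), 1 ≤ n → IsSmooth (1 / 2) K L →
        ∀ t : ℝ, 0 ≤ t → deviationProb L t ≤
          8 * Real.exp (-(t ^ (2 / Real.logb (b : ℝ) ((b : ℝ) / 2)) / (c * (n : ℝ)))) := by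
  classical
  have hb3 : (3 : ℝ) ≤ b := by exact_mod_cast hb
  have hα : 0 < Real.logb b ((b : ℝ) / 2) := Real.logb_pos (by linarith) (by linarith)
  have hα1 : Real.logb b ((b : ℝ) / 2) ≤ 1 := by
    rw [Real.logb_le_iff_le_rpow (by linarith) (by positivity), Real.rpow_one]
    linarith
  refine ⟨8 * (8 * (6 * K * b)) ^ (2 / Real.logb b ((b : ℝ) / 2)), by positivity,
    fun δ n L hn hL t ht => ?_⟩
  have : NeZero b := ⟨by omega⟩
  rw [deviationProb_eq (by omega), div_le_iff₀ (by exact_mod_cast Fintype.card_pos), mul_comm]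
  have h := card_abs_deviation_le hn (by positivity) hα hα1 (hL.holder hb hK) ht
  convert h using 2

theorem exists_deviationProb_le_of_two {K : ℝ} (hK : 0 < K) :
    ∃ c : ℝ, 0 < c ∧
      ∀ (δ n : ℕ) (L : (Fin n → Leaf 2 δ) → ℝ), 1 ≤ n → IsSmooth (1 / 2) K L →
        ∀ t : ℝ, 0 ≤ t → deviationProb L t ≤
          8 * Real.exp (-((2 : ℝ) ^ (t / c) / (8 * (n : ℝ)))) := by
  classical
  refine ⟨2 * K, by positivity, fun δ n L hn hL t _ => ?_⟩
  have hn0 : (0 : ℝ) < n := by exact_mod_cast hn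
  have hN : (0 : ℝ) < Fintype.card (Fin n → Leaf 2 δ) := by exact_mod_cast Fintype.card_pos
  set k := max 2 n with hk
  set c := Nat.clog 2 k with hc
  -- With `b * lam = 1` each level adds 1 to `Top`, so even changing all points costs only a
  -- logarithm of `n`.
  have hosc : ∀ X Y, L X ≤ L Y + 2 * K * c := by
    intro X Y
    have hH : hammingDist X Y ≤ k := by
      have := hammingDist_le_card_fintype (x := X) (y := Y)
      rw [Fintype.card_fin] at this
      omega
    refine (hL X Y k (le_max_left _ _) hH).trans (add_le_add le_rfl ?_)
    have h1 : Top 2 δ (1 / 2) k ≤ c := by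
      rw [Top_half_eq]
      simp [← hc]
    rw [div_le_iff₀ (by norm_num)]
    nlinarith
  rw [deviationProb_eq (by norm_num), div_le_iff₀ hN]
  rcases le_or_gt t (2 * K * c) with ht | ht
  · have h1 : (2 : ℝ) ^ (t / (2 * K)) ≤ 4 * n := by
      have h2 : (2 : ℝ) ^ (t / (2 * K)) ≤ (2 : ℝ) ^ (c : ℝ) := by
        refine Real.rpow_le_rpow_of_exponent_le (by norm_num) ?_
        rw [div_le_iff₀ (by positivity)]
        linarith
      have hc1 : 1 ≤ c := Nat.clog_pos (by norm_num) (lt_of_lt_of_le (by norm_num) (le_max_left 2 n))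
      obtain ⟨e, he⟩ : ∃ e, c = e + 1 := ⟨c - 1, by omega⟩
      have h3 : 2 ^ c ≤ 4 * n := by
        have := Nat.pow_pred_clog_lt_self (b := 2) (by norm_num) (le_max_left 2 n)
        rw [← hk, ← hc, he, Nat.pred_succ] at this
        rw [he, pow_succ]
        omega
      rw [Real.rpow_natCast] at h2
      exact h2.trans (by exact_mod_cast h3)
    have h2 : (2 : ℝ) ^ (t / (2 * K)) / (8 * n) ≤ 1 / 2 := by
      rw [div_le_iff₀ (by positivity)]
      linarith
    have h3 := Real.add_one_le_exp (-((2 : ℝ) ^ (t / (2 * K)) / (8 * n)))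
    have h4 : ((Finset.univ.filter fun X => t ≤ |L X - 𝔼 Y, L Y|).card : ℝ) ≤
        Fintype.card (Fin n → Leaf 2 δ) := by
      exact_mod_cast Finset.card_le_univ _
    nlinarith
  · have hempty : (Finset.univ.filter fun X => t ≤ |L X - 𝔼 Y, L Y|) = ∅ := by
      refine Finset.filter_false_of_mem fun X _ => not_le.2 (lt_of_le_of_lt ?_ ht)
      rw [← Fintype.expect_const (ι := Fin n → Leaf 2 δ) (L X), ← Finset.expect_sub_distrib]
      refine (Finset.abs_expect_le _ _).trans (Finset.expect_le Finset.univ_nonempty fun Y _ => ?_)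
      rw [abs_le]
      constructor <;> linarith [hosc X Y, hosc Y X]
    rw [hempty, Finset.card_empty, Nat.cast_zero]
    positivity

theorem two_div_logb_two_pow {d : ℕ} (hd : 2 ≤ d) :
    2 / Real.logb ((2 ^ d : ℕ) : ℝ) (((2 ^ d : ℕ) : ℝ) / 2) = 2 * (d : ℝ) / ((d : ℝ) - 1) := by
  have hd2 : (2 : ℝ) ≤ d := by exact_mod_cast hd
  have hlog : Real.log 2 ≠ 0 := (Real.log_pos (by norm_num)).ne'
  have h1 : (d : ℝ) - 1 ≠ 0 := by linarith
  push_cast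
  rw [Real.logb, Real.log_div (by positivity) (by norm_num), Real.log_pow]
  have h2 : (d : ℝ) * Real.log 2 - Real.log 2 = ((d : ℝ) - 1) * Real.log 2 := by ring
  rw [h2]
  field_simp

theorem isSmooth_of_mem_monochromatic (hb : 2 ≤ b) (hn : 1 ≤ n) {L : (Fin n → Leaf b δ) → ℝ}
    (hL : L ∈ monochromatic b δ n (1 / 2)) : IsSmooth (1 / 2) 8 L := by
  rcases hL with rfl | rfl | rfl
  · exact (isSmooth_matchingCost hb (by norm_num) (by norm_num)).mono (by norm_num) (by norm_num)
      (by norm_num)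
  · exact isSmooth_tspCost hb hn (by norm_num) (by norm_num)
  · exact (isSmooth_mstCost hb hn (by norm_num) (by norm_num)).mono (by norm_num) (by norm_num)
      (by norm_num)

end Smooth

end HST

end

theorem mainTheorem6 :
    -- smoothness of the three functionals
    (∀ (b δ n : ℕ) (lam : ℝ), 2 ≤ b → 1 ≤ n → 0 < lam → lam < 1 → 1 ≤ (b : ℝ) * lam →
      HST.IsSmooth lam 2 (HST.matchingCost lam : (Fin n → HST.Leaf b δ) → ℝ) ∧
      HST.IsSmooth lam 8 (HST.tspCost lam : (Fin n → HST.Leaf b δ) → ℝ)) ∧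
    (∃ K : ℝ, 0 < K ∧
      ∀ (b δ n : ℕ) (lam : ℝ), 2 ≤ b → 1 ≤ n → 0 < lam → lam < 1 → 1 ≤ (b : ℝ) * lam →
        HST.IsSmooth lam K (HST.mstCost lam : (Fin n → HST.Leaf b δ) → ℝ)) ∧
    -- concentration of smooth functionals around the mean, for weight ratio 1/2
    (∀ b : ℕ, 3 ≤ b → ∀ K : ℝ, 0 < K → ∃ c : ℝ, 0 < c ∧
      ∀ (δ n : ℕ) (L : (Fin n → HST.Leaf b δ) → ℝ), 1 ≤ n → HST.IsSmooth (1 / 2) K L →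
        ∀ t : ℝ, 0 ≤ t → HST.deviationProb L t ≤
          8 * Real.exp (-(t ^ (2 / Real.logb (b : ℝ) ((b : ℝ) / 2)) / (c * (n : ℝ))))) ∧
    (∀ d : ℕ, 2 ≤ d → ∀ K : ℝ, 0 < K → ∃ c : ℝ, 0 < c ∧
      ∀ (δ n : ℕ) (L : (Fin n → HST.Leaf (2 ^ d) δ) → ℝ), 1 ≤ n → HST.IsSmooth (1 / 2) K L →
        ∀ t : ℝ, 0 ≤ t → HST.deviationProb L t ≤
          8 * Real.exp (-(t ^ (2 * (d : ℝ) / ((d : ℝ) - 1)) / (c * (n : ℝ))))) ∧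
    (∀ K : ℝ, 0 < K → ∃ c : ℝ, 0 < c ∧
      ∀ (δ n : ℕ) (L : (Fin n → HST.Leaf 2 δ) → ℝ), 1 ≤ n → HST.IsSmooth (1 / 2) K L →
        ∀ t : ℝ, 0 ≤ t → HST.deviationProb L t ≤
          8 * Real.exp (-((2 : ℝ) ^ (t / c) / (8 * (n : ℝ))))) ∧
    -- concentration of the three functionals around the mean, for weight ratio 1/2
    (∀ b : ℕ, 3 ≤ b → ∃ c : ℝ, 0 < c ∧
      ∀ (δ n : ℕ), 1 ≤ n → ∀ L ∈ HST.monochromatic b δ n (1 / 2),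
        ∀ t : ℝ, 0 ≤ t → HST.deviationProb L t ≤
          8 * Real.exp (-(t ^ (2 / Real.logb (b : ℝ) ((b : ℝ) / 2)) / (c * (n : ℝ))))) ∧
    (∀ d : ℕ, 2 ≤ d → ∃ c : ℝ, 0 < c ∧
      ∀ (δ n : ℕ), 1 ≤ n → ∀ L ∈ HST.monochromatic (2 ^ d) δ n (1 / 2),
        ∀ t : ℝ, 0 ≤ t → HST.deviationProb L t ≤
          8 * Real.exp (-(t ^ (2 * (d : ℝ) / ((d : ℝ) - 1)) / (c * (n : ℝ))))) ∧
    (∃ c : ℝ, 0 < c ∧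
      ∀ (δ n : ℕ), 1 ≤ n → ∀ L ∈ HST.monochromatic 2 δ n (1 / 2),
        ∀ t : ℝ, 0 ≤ t → HST.deviationProb L t ≤
          8 * Real.exp (-((2 : ℝ) ^ (t / c) / (8 * (n : ℝ))))) := by
  have hpow : ∀ d : ℕ, 2 ≤ d → 3 ≤ 2 ^ d := fun d hd => by
    have := Nat.pow_le_pow_right (n := 2) (by norm_num) hd
    omega
  refine ⟨fun b δ n lam hb hn h0 h1 _ =>
      ⟨HST.isSmooth_matchingCost hb h0 h1, HST.isSmooth_tspCost hb hn h0 h1⟩,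
    ⟨4, by norm_num, fun b δ n lam hb hn h0 h1 _ => HST.isSmooth_mstCost hb hn h0 h1⟩,
    fun b hb K hK => HST.exists_deviationProb_le hb hK, fun d hd K hK => ?_,
    fun K hK => HST.exists_deviationProb_le_of_two hK, fun b hb => ?_, fun d hd => ?_, ?_⟩
  · rw [← HST.two_div_logb_two_pow hd]
    exact HST.exists_deviationProb_le (hpow d hd) hK
  -- The largest of the three smoothness constants 2, 8 and 4 serves all functionals.
  · obtain ⟨c, hc, h⟩ := HST.exists_deviationProb_le hb (K := 8) (by norm_num)
    exact ⟨c, hc, fun δ n hn L hL => h δ n L hn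
      (HST.isSmooth_of_mem_monochromatic (by omega) hn hL)⟩
  · rw [← HST.two_div_logb_two_pow hd]
    obtain ⟨c, hc, h⟩ := HST.exists_deviationProb_le (hpow d hd) (K := 8) (by norm_num)
    exact ⟨c, hc, fun δ n hn L hL => h δ n L hn
      (HST.isSmooth_of_mem_monochromatic (by have := hpow d hd; omega) hn hL)⟩
  · obtain ⟨c, hc, h⟩ := HST.exists_deviationProb_le_of_two (K := 8) (by norm_num)
    exact ⟨c, hc, fun δ n hn L hL => h δ n L hn
      (HST.isSmooth_of_mem_monochromatic le_rfl hn hL)⟩
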